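/- Let $d\in\{2,3\}$, let $k\ge 1$ be an integer, and let $\alpha>0$ and $\sigma>0$ be real numbers. Then there is a constant $\bar\beta>0$, depending only on $d,k,\alpha,\sigma$ (in particular not on the mesh size), with the following property. Let $\Omega\subset\mathbb R^d$ be a polygonal ($d=2$) or polyhedral ($d=3$) domain (open and connected), and let $\mathcal T$ be a finite conforming triangulation of $\overline\Omega$ by closed $d$-simplices $K$ (any two of them meet in a common face or not at all) that is shape regular with parameter $\sigma$: $h_K\le\sigma\rho_K$ for all $K\in\mathcal T$, where $h_K$ is the diameter of $K$ and $\rho_K$ the diameter of the largest ball contained in $K$. Let $\mathcal F$ be the set of all $(d-1)$-dimensional facets of the cells, $\Gamma^0$ their union, $n$ the outward unit normal on $\partial K$, and $P_k(D)$ the polynomials of degree at most $k$ on $D$. Put $$V_h=\{v\in [L^2(\Omega)]^d:\ v|_K\in [P_k(K)]^d\ \ \forall K\in\mathcal T\},$$ $$\bar V_h=\{\bar v\in [L^2(\Gamma^0)]^d:\ \bar v|_F\in [P_k(F)]^d\ \ \forall F\in\mathcal F,\ \bar v=0\text{ on }\partial\Omega\},$$ $$\bar Q_h=\{\bar q\in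 L^2(\Gamma^0):\ \bar q|_F\in P_k(F)\ \ \forall F\in\mathcal F\},$$ $$|||(v,\bar v)|||_v^2=\sum_{K\in\mathcal T}\|\nabla v\|_{L^2(K)}^2+\sum_{K\in\mathcal T}\alpha h_K^{-1}\|\bar v-v\|_{L^2(\partial K)}^2,\qquad \|\bar q\|_p^2=\sum_{K\in\mathcal T}h_K\|\bar q\|_{L^2(\partial K)}^2,$$ where on $\partial K$ the trace of $v$ is taken from inside $K$. Then for every $\bar q_h\in\bar Q_h$ $$\bar\beta\,\|\bar q_h\|_p\ \le\ \sup_{\substack{(v_h,\bar v_h)\in V_h\times\bar V_h\\ |||(v_h,\bar v_h)|||_v\neq 0}}\ \frac{\sum_{K\in\mathcal T}\int_{\partial K}(v_h\cdot n)\,\bar q_h\,ds}{|||(v_h,\bar v_h)|||_v}.$$ -/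

import Mathlib

open MeasureTheory

noncomputable section

namespace HDG

/-- Euclidean space `ℝ^d`. -/
abbrev E (d : ℕ) : Type := EuclideanSpace ℝ (Fin d)

/-- A (conforming, simplicial) triangulation of `Ω ⊆ ℝ^d`: a finite simplicial complex whose
underlying space is the closure of `Ω`. Simplices are stored as finite sets of vertices. -/
structure Triangulation (d : ℕ) (Ω : Set (E d)) where
  complex : Geometry.SimplicialComplex ℝ (E d)
  finite_faces : complex.faces.Finite
  space_eq : complex.space = closure Ω

/-- The closed simplex with vertex set `s`. -/
def simplex {d : ℕ} (s : Finset (E d)) : Set (E d) := convexHull ℝ (s : Set (E d))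

/-- The open simplex spanned by the vertices of a cell. -/
def openCell {d : ℕ} (K : Finset (E d)) : Set (E d) := interior (simplex K)

/-- The facets of a cell `K` with `d + 1` vertices are its faces with `d` vertices. -/
def cellFacets {d : ℕ} (K : Finset (E d)) : Finset (Finset (E d)) := K.powersetCard d

/-- The length measure `h_K`: the diameter of the cell. -/
def hK {d : ℕ} (K : Finset (E d)) : ℝ := Metric.diam (simplex K)

/-- The outward unit normal of `K` on its facet `F`: the vector from the centroid of `K` to the
centroid of `F`, projected onto the orthogonal complement of the direction of `F`, normalized. -/
def normal {d : ℕ} (K F : Finset (E d)) : E d :=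
  let w : E d := (vectorSpan ℝ (F : Set (E d)))ᗮ.starProjection
    (F.centroid ℝ id - K.centroid ℝ id)
  ‖w‖⁻¹ • w

/-- `(d-1)`-dimensional surface measure on `ℝ^d`. -/
def surf (d : ℕ) : Measure (E d) := μHE[d - 1]

/-- `∫_{∂K} g ds` for an integrand `g F x` that may depend on the facet `F ∋ x` of `K`. -/
def boundaryIntegral {d : ℕ} (K : Finset (E d)) (g : Finset (E d) → E d → ℝ) : ℝ :=
  ∑ F ∈ cellFacets K, ∫ x in simplex F, g F x ∂(surf d)

/-- `f` is (the function of) a polynomial on `ℝ^d` of total degree at most `k`. -/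
def IsPoly {d : ℕ} (k : ℕ) (f : E d → ℝ) : Prop :=
  ∃ p : MvPolynomial (Fin d) ℝ, p.totalDegree ≤ k ∧
    ∀ x : E d, f x = MvPolynomial.eval (fun i => x i) p

/-- A vector field all of whose components are polynomials of total degree at most `k`. -/
def IsVecPoly {d : ℕ} (k : ℕ) (f : E d → E d) : Prop :=
  ∀ i : Fin d, IsPoly k (fun x => f x i)

/-- The trace on `∂K`, taken from inside the cell `K`, of a field that is discontinuous across
facets. -/
def trace {d : ℕ} (K : Finset (E d)) (v : E d → E d) : E d → E d :=
  extendFrom (openCell K) v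

/-- `|∇ v(x)|²`, the sum of the squares of all `∂_j v_i(x)`. -/
def gradSq {d : ℕ} (v : E d → E d) (x : E d) : ℝ :=
  ∑ j : Fin d, ‖fderiv ℝ v x (EuclideanSpace.single j 1)‖ ^ 2

namespace Triangulation

variable {d : ℕ} {Ω : Set (E d)}

/-- The cells of the triangulation: its `d`-dimensional simplices. -/
def cells (T : Triangulation d Ω) : Finset (Finset (E d)) :=
  T.finite_faces.toFinset.filter (fun s => s.card = d + 1)

/-- The facets of the triangulation: all facets of its cells. -/
def facets (T : Triangulation d Ω) : Finset (Finset (E d)) :=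
  T.finite_faces.toFinset.filter (fun F => ∃ K ∈ T.cells, F ∈ cellFacets K)

/-- Every cell `K` contains a ball of diameter `2 r` with `h_K ≤ σ (2 r)`, i.e. the ratio of `h_K`
to the diameter of the largest inscribed ball is at most `σ`. -/
def ShapeRegular (T : Triangulation d Ω) (σ : ℝ) : Prop :=
  ∀ K ∈ T.cells, ∃ (x : E d) (r : ℝ),
    0 < r ∧ Metric.closedBall x r ⊆ simplex K ∧ hK K ≤ σ * (2 * r)

/-- `V_h`: fields that are, on each open cell, a vector polynomial of degree at most `k`
(representatives of classes in `L²(Ω)^d`; their values outside the open cells never matter). -/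
def Vh (T : Triangulation d Ω) (k : ℕ) : Set (E d → E d) :=
  {v | ∀ K ∈ T.cells, ∃ p : E d → E d, IsVecPoly k p ∧ Set.EqOn v p (openCell K)}

/-- `V̄_h`: fields on the union of the facets that agree almost everywhere, on each facet, with a
vector polynomial of degree at most `k`, and vanish on the facets lying in `∂Ω`. -/
def Vbar (T : Triangulation d Ω) (k : ℕ) : Set (E d → E d) :=
  {vbar | (∀ F ∈ T.facets, ∃ p : E d → E d, IsVecPoly k p ∧
      vbar =ᵐ[(surf d).restrict (simplex F)] p) ∧
    ∀ F ∈ T.facets, simplex F ⊆ frontier Ω → vbar =ᵐ[(surf d).restrict (simplex F)] 0}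

/-- `Q̄_h`: functions on the union of the facets that agree almost everywhere, on each facet, with
a polynomial of degree at most `k`. -/
def Qbar (T : Triangulation d Ω) (k : ℕ) : Set (E d → ℝ) :=
  {qbar | ∀ F ∈ T.facets, ∃ p : E d → ℝ, IsPoly k p ∧
    qbar =ᵐ[(surf d).restrict (simplex F)] p}

/-- The norm `|||(v, v̄)|||_v` with parameter `α`. -/
def normV (T : Triangulation d Ω) (α : ℝ) (v vbar : E d → E d) : ℝ :=
  Real.sqrt (∑ K ∈ T.cells, (∫ x in openCell K, gradSq v x) +
    ∑ K ∈ T.cells, α * (hK K)⁻¹ * boundaryIntegral K (fun _ x => ‖vbar x - trace K v x‖ ^ 2))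

/-- The norm `‖q̄‖_p`. -/
def normP (T : Triangulation d Ω) (qbar : E d → ℝ) : ℝ :=
  Real.sqrt (∑ K ∈ T.cells, hK K * boundaryIntegral K (fun _ x => qbar x ^ 2))

/-- `b₂(q̄, (v, v̄)) = ∑_K ∫_{∂K} (v · n) q̄ ds`; it does not depend on `v̄`. -/
def b2 (T : Triangulation d Ω) (qbar : E d → ℝ) (v : E d → E d) : ℝ :=
  ∑ K ∈ T.cells, boundaryIntegral K (fun F x => inner ℝ (trace K v x) (normal K F) * qbar x)

end Triangulation

end HDG

end

/-! The supremum is bounded below by one explicit pair `(v, 0)`. Fields in `V_h` need not match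
across facets, so `v` may be built cell by cell: on each `K` a vector polynomial of degree at most
`k` with `v · n = h_K q̄` on every facet. Then `b₂(q̄, v) = ‖q̄‖_p²`, and it remains to show `|||(v,
0)|||_v ≤ √C ‖q̄‖_p` with `C` independent of the mesh; the quotient is then at least `‖q̄‖_p / √C`.

The local field is explicit. On the facet `F_i` opposite the vertex `b_i`, `q̄` is a homogeneous
polynomial of degree `k` in the barycentric coordinates (`IsPoly.exists_hpoly`). As `k ≥ 1`, each
monomial `λ^m` contains some `λ_j`, and it is carried by the field `λ^m (b_j - b_i) / height_i`. Its
normal component on `F_i` is `λ^m`. On `F_j` it vanishes because `λ_j = 0`, and on every other facet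
the edge `b_j - b_i` is tangential. The facets thus decouple (`inner_lifting_normal`).

The bounds come from scaling, without a reference cell. Norm equivalence on the standard simplex
controls the coefficients by the `L²` norm on the facet (`exists_coeff_sq_le_facet`). An inscribed
ball of radius `r` gives `|∇λ_i| ≤ 1/(2r)` and `height_i ≥ 2r`, so only the ratio `h_K / (2r) ≤ σ`
enters `exists_local_lifting`. The inequality `|v| ≥ |v · n| = h_K |q̄|` shows that the norm of the
pair is nonzero whenever `‖q̄‖_p` is. The case `‖q̄‖_p = 0` is settled by a constant field. -/

namespace HDG

/-! ### Homogeneous polynomials in barycentric coordinates -/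

/-- The standard simplex in `ℝ^n` with vertices `0, e_1, …, e_n`. -/
def refSimplex (n : ℕ) : Set (Fin n → ℝ) := {u | (∀ i, 0 ≤ u i) ∧ ∑ i, u i ≤ 1}

/-- The barycentric coordinates of a point with respect to the vertices of `refSimplex`. -/
def bary {n : ℕ} (u : Fin n → ℝ) : Fin (n + 1) → ℝ := Fin.cons (1 - ∑ i, u i) u

/-- The monomial with exponent `m`. -/
def mon {n : ℕ} (m : Fin n →₀ ℕ) (t : Fin n → ℝ) : ℝ := ∏ j, t j ^ m j

/-- The exponents of the monomials of degree `k` in `n` variables. -/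
def exps (n k : ℕ) : Finset (Fin n →₀ ℕ) := Finset.univ.finsuppAntidiag k

/-- The homogeneous polynomial of degree `k` with coefficients `c`. -/
def hpoly {n : ℕ} (k : ℕ) (c : (Fin n →₀ ℕ) → ℝ) (t : Fin n → ℝ) : ℝ :=
  ∑ m ∈ exps n k, c m * mon m t

lemma sum_bary {n : ℕ} (u : Fin n → ℝ) : ∑ j, bary u j = 1 := by
  simp [bary, Fin.sum_univ_succ]

lemma bary_nonneg {n : ℕ} {u : Fin n → ℝ} (hu : u ∈ refSimplex n) (j : Fin (n + 1)) :
    0 ≤ bary u j := by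
  refine Fin.cases ?_ (fun i => ?_) j
  · simpa [bary] using hu.2
  · simpa [bary] using hu.1 i

lemma bary_tail {n : ℕ} {t : Fin (n + 1) → ℝ} (ht : ∑ j, t j = 1) : bary (Fin.tail t) = t := by
  rw [Fin.sum_univ_succ] at ht
  refine funext fun j => Fin.cases ?_ (fun i => ?_) j
  · simp only [bary, Fin.cons_zero, Fin.tail]
    linarith
  · simp [bary, Fin.tail]

lemma tail_mem_refSimplex {n : ℕ} {t : Fin (n + 1) → ℝ} (ht : ∑ j, t j = 1)
    (h0 : ∀ j, 0 ≤ t j) : Fin.tail t ∈ refSimplex n := by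
  rw [Fin.sum_univ_succ] at ht
  refine ⟨fun i => h0 _, ?_⟩
  have := h0 0
  simp only [Fin.tail]
  linarith

@[fun_prop]
lemma continuous_bary {n : ℕ} : Continuous (bary : (Fin n → ℝ) → Fin (n + 1) → ℝ) := by
  refine continuous_pi fun j => Fin.cases ?_ (fun i => ?_) j
  · simp only [bary, Fin.cons_zero]; fun_prop
  · simp only [bary, Fin.cons_succ]; fun_prop

@[fun_prop]
lemma continuous_mon {n : ℕ} (m : Fin n →₀ ℕ) : Continuous (mon m) := by
  unfold mon; fun_prop

@[fun_prop]
lemma continuous_hpoly {n : ℕ} (k : ℕ) (c : (Fin n →₀ ℕ) → ℝ) : Continuous (hpoly k c) := by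
  unfold hpoly; fun_prop

lemma isCompact_refSimplex (n : ℕ) : IsCompact (refSimplex n) := by
  refine (isCompact_univ_pi (s := fun _ : Fin n => Set.Icc (0 : ℝ) 1)
    fun _ => isCompact_Icc).of_isClosed_subset ?_ ?_
  · refine IsClosed.inter ?_ ?_
    · change IsClosed {u : Fin n → ℝ | ∀ i, 0 ≤ u i}
      rw [Set.ofPred_forall]
      exact isClosed_iInter fun i => isClosed_le continuous_const (continuous_apply i)
    · exact isClosed_le (continuous_finsetSum _ fun i _ => continuous_apply i) continuous_const
  · intro u hu i _
    exact ⟨hu.1 i, (Finset.single_le_sum (fun j _ => hu.1 j) (Finset.mem_univ i)).trans hu.2⟩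

lemma mem_exps {n k : ℕ} {m : Fin n →₀ ℕ} : m ∈ exps n k ↔ ∑ j, m j = k := by
  simp [exps]

lemma degree_of_mem_exps {n k : ℕ} {m : Fin n →₀ ℕ} (hm : m ∈ exps n k) : ∑ j, m j = k :=
  mem_exps.1 hm

attribute [irreducible] exps

lemma eval_eq_hpoly {n k : ℕ} {P : MvPolynomial (Fin n) ℝ} (hP : P.IsHomogeneous k)
    (t : Fin n → ℝ) : MvPolynomial.eval t P = hpoly k (fun m => P.coeff m) t := by
  rw [MvPolynomial.eval_eq', hpoly]
  refine Finset.sum_subset (fun m hm => ?_) (fun m _ hm => ?_)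
  · rw [mem_exps, ← Finsupp.degree_eq_sum]
    by_contra h
    exact (MvPolynomial.mem_support_iff.1 hm) (hP.coeff_eq_zero h)
  · rw [MvPolynomial.notMem_support_iff.1 hm, zero_mul]

lemma exists_isHomogeneous_hpoly {n : ℕ} (k : ℕ) (c : (Fin n →₀ ℕ) → ℝ) :
    ∃ P : MvPolynomial (Fin n) ℝ, P.IsHomogeneous k ∧ (∀ m ∈ exps n k, P.coeff m = c m) ∧
      ∀ t, MvPolynomial.eval t P = hpoly k c t := by
  classical
  refine ⟨∑ m ∈ exps n k, MvPolynomial.monomial m (c m), ?_, fun m hm => ?_, fun t => ?_⟩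
  · refine MvPolynomial.IsHomogeneous.sum _ _ _ fun m hm => ?_
    exact MvPolynomial.isHomogeneous_monomial _
      ((Finsupp.degree_eq_sum m).trans (degree_of_mem_exps hm))
  · rw [MvPolynomial.coeff_sum]
    simp only [MvPolynomial.coeff_monomial]
    rw [Finset.sum_ite_eq' (exps n k) m c, if_pos hm]
  · rw [map_sum, hpoly]
    refine Finset.sum_congr rfl fun m _ => ?_
    rw [MvPolynomial.eval_monomial, Finsupp.prod_fintype _ _ (by simp), mon]

lemma hpoly_smul {n k : ℕ} (c : (Fin n →₀ ℕ) → ℝ) (s : ℝ) (t : Fin n → ℝ) :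
    hpoly k c (fun j => s * t j) = s ^ k * hpoly k c t := by
  rw [hpoly, hpoly, Finset.mul_sum]
  refine Finset.sum_congr rfl fun m hm => ?_
  simp only [mon, mul_pow, Finset.prod_mul_distrib, Finset.prod_pow_eq_pow_sum,
    degree_of_mem_exps hm]
  ring

/-- Homogeneity spreads the vanishing from the open simplex to the whole positive orthant. The
orthant is a product of infinite sets, on which only the zero polynomial vanishes. -/
lemma hpoly_eq_zero_of_forall_pos {n k : ℕ} {c : (Fin (n + 1) →₀ ℕ) → ℝ}
    (h : ∀ t : Fin (n + 1) → ℝ, (∀ j, 0 < t j) → ∑ j, t j = 1 → hpoly k c t = 0) :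
    ∀ m ∈ exps (n + 1) k, c m = 0 := by
  obtain ⟨P, -, hc, he⟩ := exists_isHomogeneous_hpoly k c
  have hP : P = 0 := by
    refine MvPolynomial.funext_set (fun _ => Set.Ioi (0 : ℝ)) (fun _ => Set.Ioi_infinite 0)
      fun t ht => ?_
    have ht' : ∀ j, 0 < t j := fun j => ht j trivial
    have hs : 0 < ∑ j, t j := Finset.sum_pos (fun j _ => ht' j) Finset.univ_nonempty
    have := hpoly_smul (k := k) c (∑ j, t j) (fun j => t j / ∑ j, t j)
    rw [h _ (fun j => div_pos (ht' j) hs) (by rw [← Finset.sum_div, div_self hs.ne'])] at this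
    rw [he, map_zero, ← mul_zero ((∑ j, t j) ^ k), ← this]
    congr 1
    funext j
    field_simp
  intro m hm
  rw [← hc m hm, hP, MvPolynomial.coeff_zero]

/-- A continuous positive function on a finite-dimensional space that is homogeneous of degree two
dominates the square of every coordinate. -/
lemma exists_pos_mul_sq_le {ι : Type*} [Fintype ι] (Q : (ι → ℝ) → ℝ) (hQ : Continuous Q)
    (hpos : ∀ c, c ≠ 0 → 0 < Q c) (hhom : ∀ (s : ℝ) c, Q (s • c) = s ^ 2 * Q c) :
    ∃ κ > 0, ∀ c i, κ * c i ^ 2 ≤ Q c := by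
  rcases isEmpty_or_nonempty ι with hι | hι
  · exact ⟨1, one_pos, fun c i => (hι.false i).elim⟩
  -- `κ` is the minimum of `Q` on the unit sphere of the sup norm, which dominates each coordinate.
  obtain ⟨c₀, hc₀, hmin⟩ := (isCompact_sphere (0 : ι → ℝ) 1).exists_isMinOn
    (NormedSpace.sphere_nonempty.2 zero_le_one) hQ.continuousOn
  have hne : c₀ ≠ 0 := by
    rintro rfl
    simp at hc₀
  refine ⟨Q c₀, hpos _ hne, fun c i => ?_⟩
  rcases eq_or_ne c 0 with rfl | hc
  · have := hhom 0 0
    simp at this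
    simp [this]
  have hn : 0 < ‖c‖ := norm_pos_iff.2 hc
  have h1 : Q c₀ ≤ Q (‖c‖⁻¹ • c) := hmin (by simp [norm_smul, hn.ne'])
  have h2 : Q c = ‖c‖ ^ 2 * Q (‖c‖⁻¹ • c) := by
    rw [← hhom, smul_smul, mul_inv_cancel₀ hn.ne', one_smul]
  have h3 : c i ^ 2 ≤ ‖c‖ ^ 2 := by
    rw [← sq_abs (c i)]
    have := norm_le_pi_norm c i
    rw [Real.norm_eq_abs] at this
    gcongr
  rw [h2, mul_comm]
  exact mul_le_mul h3 h1 (hpos _ hne).le (sq_nonneg _)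

lemma integrableOn_refSimplex {n : ℕ} {f : (Fin n → ℝ) → ℝ} (hf : Continuous f) :
    IntegrableOn f (refSimplex n) :=
  hf.continuousOn.integrableOn_compact (isCompact_refSimplex n)

/-- The integrand vanishes almost everywhere on the simplex, hence by continuity everywhere on the
open set of points with positive barycentric coordinates. -/
lemma hpoly_eq_zero_of_integral_eq_zero {n k : ℕ} {c : (Fin (n + 1) →₀ ℕ) → ℝ}
    (h : ∫ u in refSimplex n, hpoly k c (bary u) ^ 2 = 0) : ∀ m ∈ exps (n + 1) k, c m = 0 := by
  refine hpoly_eq_zero_of_forall_pos fun t ht hsum => ?_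
  have hcont : Continuous fun u : Fin n → ℝ => hpoly k c (bary u) ^ 2 := by fun_prop
  rw [setIntegral_eq_zero_iff_of_nonneg_ae (Filter.Eventually.of_forall fun u => sq_nonneg _)
    (integrableOn_refSimplex hcont)] at h
  let U : Set (Fin n → ℝ) := {u | ∀ j, 0 < bary u j}
  have hU : IsOpen U := by
    simp only [U, Set.ofPred_forall]
    exact isOpen_iInter_of_finite fun j => isOpen_lt continuous_const
      ((continuous_apply j).comp continuous_bary)
  have hUS : U ⊆ refSimplex n := fun u hu => by
    refine ⟨fun i => ?_, ?_⟩
    · simpa [bary] using (hu i.succ).le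
    · simpa [bary] using (hu 0).le
  have hae : (fun u : Fin n → ℝ => hpoly k c (bary u) ^ 2) =ᵐ[volume.restrict U] 0 :=
    ae_restrict_of_ae_restrict_of_subset hUS h
  have := Measure.eqOn_open_of_ae_eq hae hU hcont.continuousOn continuousOn_const
  have htU : Fin.tail t ∈ U := fun j => by
    rw [bary_tail hsum]; exact ht j
  have := this htU
  simpa [bary_tail hsum] using this

/-- The coefficients of a homogeneous polynomial are controlled by its `L²` norm on the standard
simplex. -/
lemma exists_coeff_sq_le_integral (n k : ℕ) :
    ∃ κ > 0, ∀ (c : (Fin (n + 1) →₀ ℕ) → ℝ), ∀ m ∈ exps (n + 1) k,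
      κ * c m ^ 2 ≤ ∫ u in refSimplex n, hpoly k c (bary u) ^ 2 := by
  classical
  -- Compactness of the sphere needs finitely many coefficients, so `Q` lives on families indexed by
  -- `exps (n + 1) k`, extended by zero.
  let ext : (exps (n + 1) k → ℝ) → (Fin (n + 1) →₀ ℕ) → ℝ :=
    fun c m => if h : m ∈ exps (n + 1) k then c ⟨m, h⟩ else 0
  have hext : ∀ c t, hpoly k (ext c) t = ∑ m : exps (n + 1) k, c m * mon m t := by
    intro c t
    rw [hpoly, ← Finset.sum_coe_sort]
    exact Finset.sum_congr rfl fun m _ => by simp [ext]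
  let Q : (exps (n + 1) k → ℝ) → ℝ :=
    fun c => ∫ u in refSimplex n, hpoly k (ext c) (bary u) ^ 2
  -- Expansion by the Gram matrix of the monomials; continuity and homogeneity of degree two can be
  -- read off from it.
  have hQ : ∀ c, Q c = ∑ a : exps (n + 1) k, ∑ b : exps (n + 1) k,
      c a * c b * ∫ u in refSimplex n, mon a (bary u) * mon b (bary u) := by
    intro c
    have hintg : ∀ a b : exps (n + 1) k, IntegrableOn
        (fun u : Fin n → ℝ => c a * c b * (mon a (bary u) * mon b (bary u)))
        (refSimplex n) := fun a b => integrableOn_refSimplex (by fun_prop)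
    simp only [← integral_const_mul]
    simp_rw [← integral_finsetSum (Finset.univ : Finset (exps (n + 1) k)) (fun b _ => hintg _ b)]
    rw [← integral_finsetSum _ (fun a _ => integrable_finsetSum _ fun b _ => hintg a b)]
    refine integral_congr_ae (Filter.Eventually.of_forall fun u => ?_)
    simp only [hext, sq, Finset.sum_mul_sum]
    exact Finset.sum_congr rfl fun a _ => Finset.sum_congr rfl fun b _ => by ring
  have hsm : ∀ (s : ℝ) c, Q (s • c) = s ^ 2 * Q c := by
    intro s c
    simp only [hQ, Finset.mul_sum, Pi.smul_apply, smul_eq_mul]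
    exact Finset.sum_congr rfl fun a _ => Finset.sum_congr rfl fun b _ => by ring
  have hcont : Continuous Q := by
    rw [funext hQ]
    fun_prop
  have hpos : ∀ c, c ≠ 0 → 0 < Q c := by
    intro c hc
    refine lt_of_le_of_ne (integral_nonneg fun u => sq_nonneg _) fun h0 => hc ?_
    funext m
    have := hpoly_eq_zero_of_integral_eq_zero h0.symm m m.2
    simpa [ext] using this
  obtain ⟨κ, hκ, h⟩ := exists_pos_mul_sq_le Q hcont hpos hsm
  refine ⟨κ, hκ, fun c m hm => ?_⟩
  refine (h (fun m : exps (n + 1) k => c m) ⟨m, hm⟩).trans_eq ?_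
  refine integral_congr_ae (Filter.Eventually.of_forall fun u => ?_)
  have : hpoly k (ext fun m : exps (n + 1) k => c m) (bary u) = hpoly k c (bary u) :=
    (hext _ _).trans (Finset.sum_coe_sort (exps (n + 1) k) (fun m => c m * mon m (bary u)))
  exact congrArg (· ^ 2) this

/-- A polynomial of degree at most `k` is homogeneous of degree `k` in barycentric coordinates. -/
lemma IsPoly.exists_hpoly {d n k : ℕ} {f : E d → ℝ} (hf : IsPoly k f) (x : Fin n → E d) :
    ∃ c : (Fin n →₀ ℕ) → ℝ, ∀ t : Fin n → ℝ, ∑ j, t j = 1 →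
      f (∑ j, t j • x j) = hpoly k c t := by
  obtain ⟨p, hp, hf⟩ := hf
  let lin (l : Fin d) : MvPolynomial (Fin n) ℝ := ∑ j, MvPolynomial.C (x j l) * MvPolynomial.X j
  -- Each coordinate of the point becomes the linear form `lin l` in `t`. The missing degree of a
  -- monomial is supplied by a power of `∑ t_j`, which equals `1` at the points considered.
  let P : MvPolynomial (Fin n) ℝ := ∑ m ∈ p.support, MvPolynomial.C (p.coeff m) *
    ((∏ l, lin l ^ m l) * (∑ j, MvPolynomial.X j) ^ (k - ∑ l, m l))
  have hdeg : ∀ m ∈ p.support, ∑ l, m l ≤ k := fun m hm => by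
    have := (MvPolynomial.le_totalDegree hm).trans hp
    rwa [Finsupp.sum_fintype _ _ (by simp)] at this
  have hP : P.IsHomogeneous k := by
    refine MvPolynomial.IsHomogeneous.sum _ _ _ fun m hm => ?_
    have h1 : (∏ l, lin l ^ m l).IsHomogeneous (∑ l, m l) := by
      refine MvPolynomial.IsHomogeneous.prod _ _ _ fun l _ => ?_
      have := (MvPolynomial.IsHomogeneous.sum Finset.univ
        (fun j => MvPolynomial.C (x j l) * MvPolynomial.X j) 1
        fun j _ => MvPolynomial.isHomogeneous_C_mul_X (x j l) j).pow (m l)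
      rwa [one_mul] at this
    have h2 : ((∑ j : Fin n, MvPolynomial.X j : MvPolynomial (Fin n) ℝ) ^
        (k - ∑ l, m l)).IsHomogeneous (k - ∑ l, m l) := by
      have := (MvPolynomial.IsHomogeneous.sum Finset.univ
        (fun j => (MvPolynomial.X j : MvPolynomial (Fin n) ℝ)) 1
        fun j _ => MvPolynomial.isHomogeneous_X ℝ j).pow (k - ∑ l, m l)
      rwa [one_mul] at this
    have := (h1.mul h2).C_mul (p.coeff m)
    rwa [Nat.add_sub_cancel' (hdeg m hm)] at this
  refine ⟨fun m => P.coeff m, fun t ht => ?_⟩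
  rw [← eval_eq_hpoly hP, hf, MvPolynomial.eval_eq', map_sum]
  refine Finset.sum_congr rfl fun m _ => ?_
  simp [lin, ht, mul_comm]

end HDG

/-! ### Parametrized facets and surface measure -/

namespace HDG

open scoped ENNReal NNReal

/-- The affine parametrization of the simplex with vertices `y` by the standard simplex. -/
def facetMap {n d : ℕ} (y : Fin (n + 1) → E d) (u : Fin n → ℝ) : E d := ∑ j, bary u j • y j

lemma convexHull_range_eq_image {ι V : Type*} [Fintype ι] [AddCommGroup V] [Module ℝ V]
    (y : ι → V) :
    convexHull ℝ (Set.range y) = (fun t : ι → ℝ => ∑ j, t j • y j) '' stdSimplex ℝ ι := by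
  classical
  rw [← convexHull_rangle_single_eq_stdSimplex]
  change _ = Fintype.linearCombination ℝ y '' _
  rw [LinearMap.image_convexHull, ← Set.range_comp]
  congr 2
  funext j
  simp

lemma facetMap_image {n d : ℕ} (y : Fin (n + 1) → E d) :
    facetMap y '' refSimplex n = convexHull ℝ (Set.range y) := by
  rw [convexHull_range_eq_image]
  apply Set.Subset.antisymm
  · rintro _ ⟨u, hu, rfl⟩
    exact ⟨bary u, ⟨bary_nonneg hu, sum_bary u⟩, rfl⟩
  · rintro _ ⟨t, ⟨h0, h1⟩, rfl⟩
    exact ⟨Fin.tail t, tail_mem_refSimplex h1 h0, by simp [facetMap, bary_tail h1]⟩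

@[fun_prop]
lemma continuous_facetMap {n d : ℕ} (y : Fin (n + 1) → E d) : Continuous (facetMap y) := by
  unfold facetMap
  fun_prop

lemma facetMap_sub {n d : ℕ} (y : Fin (n + 1) → E d) (u u' : Fin n → ℝ) :
    facetMap y u - facetMap y u' = ∑ i, (u i - u' i) • (y i.succ - y 0) := by
  simp only [facetMap, Fin.sum_univ_succ, bary, Fin.cons_zero, Fin.cons_succ, smul_sub, sub_smul,
    Finset.sum_sub_distrib, Finset.sum_smul, one_smul]
  abel

lemma lipschitzWith_facetMap {n d : ℕ} {y : Fin (n + 1) → E d} {h : ℝ}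
    (hy : ∀ i j, dist (y i) (y j) ≤ h) : LipschitzWith (Real.toNNReal (n * h)) (facetMap y) := by
  have h0 : 0 ≤ h := dist_nonneg.trans (hy 0 0)
  refine LipschitzWith.of_dist_le_mul fun u u' => ?_
  rw [Real.coe_toNNReal _ (by positivity), dist_eq_norm, facetMap_sub]
  calc ‖∑ i, (u i - u' i) • (y i.succ - y 0)‖ ≤ ∑ i : Fin n, dist u u' * h := by
        refine norm_sum_le_of_le _ fun i _ => ?_
        rw [norm_smul, ← dist_eq_norm, ← dist_eq_norm]
        exact mul_le_mul (dist_le_pi_dist u u' i) (hy _ _) dist_nonneg dist_nonneg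
    _ = n * h * dist u u' := by
        simp
        ring

lemma volume_refSimplex_lt_top (n : ℕ) : volume (refSimplex n) < ∞ :=
  (isCompact_refSimplex n).measure_lt_top

/-- The constant relating the surface measure and the Hausdorff measure. -/
noncomputable def surfFactor (n : ℕ) : ℝ≥0 :=
  Measure.addHaarScalarFactor (volume : Measure (EuclideanSpace ℝ (Fin n))) μH[n]

lemma surfFactor_pos (n : ℕ) : 0 < surfFactor n :=
  pos_iff_ne_zero.2 (Measure.addHaarScalarFactor_volume_hausdorffMeasure_ne_zero n)

lemma surf_apply (n : ℕ) (s : Set (E (n + 1))) : surf (n + 1) s = surfFactor n * μH[n] s := by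
  change ((surfFactor n) • (μH[n] : Measure (E (n + 1)))) s = _
  rw [Measure.smul_apply]
  rfl

/-- This is why the parameter space carries the sup metric: its Hausdorff measure is Lebesgue
measure, so (anti)Lipschitz bounds for `facetMap` compare `surf` with `volume` directly, up to
`surfFactor`. -/
lemma hausdorffMeasure_pi_fin (n : ℕ) : (μH[n] : Measure (Fin n → ℝ)) = volume := by
  have := hausdorffMeasure_pi_real (ι := Fin n)
  rwa [Fintype.card_fin] at this

lemma surf_convexHull_le {n : ℕ} {y : Fin (n + 1) → E (n + 1)} {h : ℝ}
    (hy : ∀ i j, dist (y i) (y j) ≤ h) :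
    surf (n + 1) (convexHull ℝ (Set.range y)) ≤
      surfFactor n * ((Real.toNNReal (n * h) : ℝ≥0∞) ^ n * volume (refSimplex n)) := by
  rw [surf_apply, ← facetMap_image, ← hausdorffMeasure_pi_fin]
  gcongr
  have := (lipschitzWith_facetMap hy).hausdorffMeasure_image_le (d := n) (Nat.cast_nonneg n)
    (refSimplex n)
  rwa [ENNReal.rpow_natCast] at this

lemma surf_convexHull_lt_top {n : ℕ} (y : Fin (n + 1) → E (n + 1)) :
    surf (n + 1) (convexHull ℝ (Set.range y)) < ∞ := by
  -- Only finiteness matters here, so the sum of all distances serves as a crude bound.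
  have hy : ∀ i j, dist (y i) (y j) ≤ ∑ i, ∑ j, dist (y i) (y j) := fun i j =>
    (Finset.single_le_sum (f := fun j => dist (y i) (y j)) (fun _ _ => dist_nonneg)
      (Finset.mem_univ j)).trans
    (Finset.single_le_sum (f := fun i => ∑ j, dist (y i) (y j))
      (fun _ _ => Finset.sum_nonneg fun _ _ => dist_nonneg) (Finset.mem_univ i))
  refine (surf_convexHull_le hy).trans_lt ?_
  exact ENNReal.mul_lt_top ENNReal.coe_lt_top
    (ENNReal.mul_lt_top (by finiteness) (volume_refSimplex_lt_top n))

/-- The surface measure of a facet of diameter at most `h` is `O(h^n)`. -/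
lemma exists_surf_real_le (n : ℕ) : ∃ C : ℝ, 0 ≤ C ∧
    ∀ (y : Fin (n + 1) → E (n + 1)) (h : ℝ), (∀ i j, dist (y i) (y j) ≤ h) →
      (surf (n + 1)).real (convexHull ℝ (Set.range y)) ≤ C * h ^ n := by
  refine ⟨surfFactor n * (n ^ n * volume.real (refSimplex n)), by positivity, fun y h hy => ?_⟩
  have h0 : 0 ≤ h := dist_nonneg.trans (hy 0 0)
  have := ENNReal.toReal_mono (ENNReal.mul_lt_top ENNReal.coe_lt_top
    (ENNReal.mul_lt_top (by finiteness) (volume_refSimplex_lt_top n))).ne (surf_convexHull_le hy)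
  refine this.trans_eq ?_
  simp only [ENNReal.toReal_mul, ENNReal.coe_toReal, ENNReal.toReal_pow, Measure.real]
  rw [Real.coe_toNNReal _ (by positivity)]
  ring

lemma isCompact_convexHull_range {n d : ℕ} (y : Fin n → E d) :
    IsCompact (convexHull ℝ (Set.range y)) := (Set.finite_range y).isCompact_convexHull ℝ

lemma integrableOn_convexHull_surf {n : ℕ} (y : Fin (n + 1) → E (n + 1)) {g : E (n + 1) → ℝ}
    (hg : Continuous g) : IntegrableOn g (convexHull ℝ (Set.range y)) (surf (n + 1)) := by
  obtain ⟨M, hM⟩ := (isCompact_convexHull_range y).exists_bound_of_continuousOn hg.continuousOn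
  exact Measure.integrableOn_of_bounded (surf_convexHull_lt_top y).ne hg.aestronglyMeasurable
    (ae_restrict_of_forall_mem (isCompact_convexHull_range y).measurableSet hM)

/-- If the barycentric coordinates of a facet are `L`-Lipschitz, integration over the facet
dominates integration over the standard simplex. -/
lemma integral_refSimplex_le {n : ℕ} {y : Fin (n + 1) → E (n + 1)} {L : ℝ≥0}
    (hL : AntilipschitzWith L (facetMap y)) {g : E (n + 1) → ℝ} (hg : Continuous g)
    (hg0 : ∀ x, 0 ≤ g x) :
    ∫ u in refSimplex n, g (facetMap y u) ≤
      (surfFactor n : ℝ)⁻¹ * (L : ℝ) ^ n *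
        ∫ x in convexHull ℝ (Set.range y), g x ∂(surf (n + 1)) := by
  set F := convexHull ℝ (Set.range y) with hF
  -- The antilipschitz bound is turned into an inequality of measures, which can be integrated
  -- against any nonnegative `g`.
  have hle : (volume.restrict (refSimplex n)).map (facetMap y) ≤
      ((surfFactor n)⁻¹ * L ^ n) • (surf (n + 1)).restrict F := by
    refine Measure.le_iff.2 fun A hA => ?_
    rw [Measure.map_apply (continuous_facetMap y).measurable hA,
      Measure.restrict_apply ((continuous_facetMap y).measurable hA), Measure.smul_apply,
      Measure.restrict_apply hA, surf_apply, ← hausdorffMeasure_pi_fin]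
    have h1 := hL.le_hausdorffMeasure_image (d := n) (Nat.cast_nonneg n)
      (facetMap y ⁻¹' A ∩ refSimplex n)
    rw [ENNReal.rpow_natCast] at h1
    have h2 : facetMap y '' (facetMap y ⁻¹' A ∩ refSimplex n) ⊆ A ∩ F := by
      rintro _ ⟨u, ⟨hu, hu'⟩, rfl⟩
      exact ⟨hu, hF ▸ facetMap_image y ▸ Set.mem_image_of_mem _ hu'⟩
    refine h1.trans ((mul_le_mul_right (measure_mono h2) _).trans_eq ?_)
    have h3 : ((surfFactor n)⁻¹ * L ^ n) * surfFactor n = L ^ n := by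
      have := (surfFactor_pos n).ne'
      field_simp
    rw [ENNReal.smul_def, smul_eq_mul, ← mul_assoc, ← ENNReal.coe_mul, h3, ENNReal.coe_pow]
  have hintg : IntegrableOn g F (surf (n + 1)) := integrableOn_convexHull_surf y hg
  have := integral_mono_measure hle (Filter.Eventually.of_forall hg0) hintg.smul_measure_nnreal
  rw [integral_map (continuous_facetMap y).aemeasurable hg.aestronglyMeasurable,
    integral_smul_nnreal_measure] at this
  refine this.trans_eq ?_
  rw [NNReal.smul_def]
  simp

end HDG

/-! ### Geometry of a cell: barycentric coordinates, normals, heights -/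

namespace HDG

open scoped ENNReal NNReal

variable {n : ℕ} (b : AffineBasis (Fin (n + 2)) ℝ (E (n + 1)))

/-- The vertices of the cell spanned by an affine basis. -/
noncomputable def vertices : Finset (E (n + 1)) := Finset.univ.map ⟨b, b.ind.injective⟩

/-- The vertices of the facet opposite to the `i`-th vertex. -/
noncomputable def facetVertices (i : Fin (n + 2)) : Finset (E (n + 1)) :=
  Finset.univ.map ⟨b ∘ i.succAbove, b.ind.injective.comp Fin.succAbove_right_injective⟩

lemma coe_vertices : (vertices b : Set (E (n + 1))) = Set.range b := by
  simp [vertices]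

lemma coe_facetVertices (i : Fin (n + 2)) :
    (facetVertices b i : Set (E (n + 1))) = Set.range (b ∘ i.succAbove) := by
  simp [facetVertices, Function.comp_def]

lemma simplex_vertices : simplex (vertices b) = convexHull ℝ (Set.range b) := by
  rw [simplex, coe_vertices]

lemma simplex_facetVertices (i : Fin (n + 2)) :
    simplex (facetVertices b i) = convexHull ℝ (Set.range (b ∘ i.succAbove)) := by
  rw [simplex, coe_facetVertices]

lemma facetVertices_eq_erase [DecidableEq (E (n + 1))] (i : Fin (n + 2)) :
    facetVertices b i = (vertices b).erase (b i) := by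
  ext x
  simp only [facetVertices, vertices, Finset.mem_map, Finset.mem_univ, true_and,
    Function.Embedding.coeFn_mk, Finset.mem_erase, Function.comp_apply]
  constructor
  · rintro ⟨j, rfl⟩
    exact ⟨fun h => Fin.succAbove_ne i j (b.ind.injective h), _, rfl⟩
  · rintro ⟨hne, j, rfl⟩
    obtain ⟨l, rfl⟩ := Fin.exists_succAbove_eq (x := j) (y := i) (by rintro rfl; exact hne rfl)
    exact ⟨l, rfl⟩

lemma facetVertices_injective : Function.Injective (facetVertices b) := by
  classical
  intro i j hij
  by_contra hne
  have h : b i ∉ facetVertices b i := by simp [facetVertices_eq_erase]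
  rw [hij, facetVertices_eq_erase] at h
  exact h (Finset.mem_erase.2 ⟨fun h => hne (b.ind.injective h), by simp [vertices]⟩)

lemma card_vertices : (vertices b).card = n + 2 := by simp [vertices]

lemma cellFacets_vertices :
    cellFacets (vertices b) =
      Finset.univ.map ⟨facetVertices b, facetVertices_injective b⟩ := by
  classical
  refine (Finset.eq_of_subset_of_card_le (fun F hF => ?_) ?_).symm
  · simp only [Finset.mem_map, Finset.mem_univ, true_and, Function.Embedding.coeFn_mk] at hF
    obtain ⟨i, rfl⟩ := hF
    refine Finset.mem_powersetCard.2 ⟨?_, by simp [facetVertices]⟩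
    rw [facetVertices_eq_erase]
    exact Finset.erase_subset _ _
  · simp [cellFacets, card_vertices, Nat.choose_succ_self_right]

lemma coord_sum {ι : Type*} [Fintype ι] {t : ι → ℝ} (ht : ∑ j, t j = 1) (x : ι → E (n + 1))
    (i : Fin (n + 2)) : b.coord i (∑ j, t j • x j) = ∑ j, t j * b.coord i (x j) := by
  have h := Finset.univ.map_affineCombination x t ht (b.coord i)
  rw [Finset.affineCombination_eq_linear_combination _ _ _ ht,
    Finset.affineCombination_eq_linear_combination _ _ _ ht] at h
  simpa using h

lemma coord_mem_Icc {y : E (n + 1)} (hy : y ∈ convexHull ℝ (Set.range b)) (i : Fin (n + 2)) :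
    b.coord i y ∈ Set.Icc (0 : ℝ) 1 := by
  rw [b.convexHull_eq_nonneg_coord] at hy
  refine ⟨hy i, ?_⟩
  rw [← b.sum_coord_apply_eq_one y]
  exact Finset.single_le_sum (fun j _ => hy j) (Finset.mem_univ i)

lemma coord_linear_sub (i : Fin (n + 2)) (x y : E (n + 1)) :
    (b.coord i).linear (x - y) = b.coord i x - b.coord i y :=
  AffineMap.linearMap_vsub _ _ _

lemma exists_of_mem_facet {i : Fin (n + 2)} {y : E (n + 1)}
    (hy : y ∈ simplex (facetVertices b i)) :
    b.coord i y = 0 ∧ ∑ j, b.coord (i.succAbove j) y = 1 ∧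
      ∑ j, b.coord (i.succAbove j) y • b (i.succAbove j) = y := by
  rw [simplex_facetVertices, convexHull_range_eq_image] at hy
  obtain ⟨t, ⟨-, ht⟩, rfl⟩ := hy
  have h0 : b.coord i (∑ j, t j • b (i.succAbove j)) = 0 := by
    rw [coord_sum b ht]
    exact Finset.sum_eq_zero fun j _ => by
      rw [b.coord_apply_ne (Fin.succAbove_ne i j).symm, mul_zero]
  have h1 : ∀ l, b.coord (i.succAbove l) (∑ j, t j • b (i.succAbove j)) = t l := fun l => by
    rw [coord_sum b ht, Finset.sum_eq_single l]
    · simp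
    · intro j _ hj
      rw [b.coord_apply_ne (fun h => hj (Fin.succAbove_right_injective h).symm), mul_zero]
    · simp
  simp only [Function.comp_apply, h0, h1, ht, true_and]

lemma facet_subset_cell (i : Fin (n + 2)) :
    simplex (facetVertices b i) ⊆ simplex (vertices b) := by
  rw [simplex_facetVertices, simplex_vertices]
  exact convexHull_mono (Set.range_comp_subset_range _ _)

/-- The gradient of a barycentric coordinate is at most the inverse of the diameter of any ball
contained in the cell. -/
lemma abs_coord_linear_le {x : E (n + 1)} {r : ℝ} (hr : 0 < r)
    (hball : Metric.closedBall x r ⊆ simplex (vertices b)) (i : Fin (n + 2)) (w : E (n + 1)) :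
    |(b.coord i).linear w| ≤ (2 * r)⁻¹ * ‖w‖ := by
  rcases eq_or_ne w 0 with rfl | hw
  · simp
  have hw' : 0 < ‖w‖ := norm_pos_iff.2 hw
  rw [simplex_vertices] at hball
  -- The chord through the centre `x` in direction `w` has length `2 r` and lies in the cell. Along
  -- it the affine function `b.coord i` stays in `[0, 1]`, which bounds its slope.
  have hmem : ∀ s : ℝ, |s| ≤ r / ‖w‖ → b.coord i (x + s • w) ∈ Set.Icc (0 : ℝ) 1 := by
    intro s hs
    refine coord_mem_Icc b (hball ?_) i
    rw [Metric.mem_closedBall, dist_eq_norm, add_sub_cancel_left, norm_smul, Real.norm_eq_abs]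
    rwa [le_div_iff₀ hw'] at hs
  have hp : 0 < r / ‖w‖ := by positivity
  have h1 := hmem (r / ‖w‖) (abs_of_pos hp).le
  have h2 := hmem (-(r / ‖w‖)) (by rw [abs_neg, abs_of_pos hp])
  have h3 : (b.coord i).linear ((2 * (r / ‖w‖)) • w) =
      b.coord i (x + (r / ‖w‖) • w) - b.coord i (x + (-(r / ‖w‖)) • w) := by
    rw [← coord_linear_sub]
    congr 1
    module
  rw [map_smul, smul_eq_mul] at h3
  have h4 : |2 * (r / ‖w‖) * (b.coord i).linear w| ≤ 1 := by
    rw [h3, abs_le]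
    constructor <;> linarith [h1.1, h1.2, h2.1, h2.2]
  rw [abs_mul, abs_of_pos (by positivity)] at h4
  rw [← div_eq_inv_mul, le_div_iff₀ (by positivity)]
  have h5 : 2 * (r / ‖w‖) * |(b.coord i).linear w| = |(b.coord i).linear w| * (2 * r) / ‖w‖ := by
    ring
  rw [h5, div_le_one hw'] at h4
  exact h4

/-- The parameter `u l` is recovered from the point as the coordinate with index `i.succAbove
l.succ` (`bary` keeps index `0` for the dependent coordinate), and the gradient bound applies to
each such coordinate. -/
lemma antilipschitzWith_facetMap {x : E (n + 1)} {r : ℝ} (hr : 0 < r)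
    (hball : Metric.closedBall x r ⊆ simplex (vertices b)) (i : Fin (n + 2)) :
    AntilipschitzWith (Real.toNNReal (2 * r)⁻¹) (facetMap (b ∘ i.succAbove)) := by
  refine AntilipschitzWith.of_le_mul_dist fun u u' => ?_
  rw [Real.coe_toNNReal _ (by positivity)]
  refine (dist_pi_le_iff (by positivity)).2 fun l => ?_
  have h := abs_coord_linear_le b hr hball (i.succAbove l.succ)
    (facetMap (b ∘ i.succAbove) u - facetMap (b ∘ i.succAbove) u')
  have h1 : (b.coord (i.succAbove l.succ)).linear
      (facetMap (b ∘ i.succAbove) u - facetMap (b ∘ i.succAbove) u') = u l - u' l := by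
    rw [facetMap_sub, map_sum, Finset.sum_eq_single l]
    · rw [map_smul, coord_linear_sub, Function.comp_apply, Function.comp_apply,
        b.coord_apply_eq, b.coord_apply_ne, sub_zero, smul_eq_mul, mul_one]
      exact fun h => Fin.succ_ne_zero l (Fin.succAbove_right_injective h)
    · intro j _ hj
      rw [map_smul, coord_linear_sub, Function.comp_apply, Function.comp_apply,
        b.coord_apply_ne, b.coord_apply_ne, sub_zero, smul_zero]
      · exact fun h => Fin.succ_ne_zero l (Fin.succAbove_right_injective h)
      · exact fun h => hj (Fin.succ_injective _ (Fin.succAbove_right_injective h)).symm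
    · simp
  rw [h1] at h
  rwa [Real.dist_eq, dist_eq_norm]

/-- The unnormalized outward normal of a facet. -/
noncomputable def rawNormal (i : Fin (n + 2)) : E (n + 1) :=
  (vectorSpan ℝ (facetVertices b i : Set (E (n + 1))))ᗮ.starProjection
    ((facetVertices b i).centroid ℝ id - (vertices b).centroid ℝ id)

lemma normal_eq (i : Fin (n + 2)) :
    normal (vertices b) (facetVertices b i) = ‖rawNormal b i‖⁻¹ • rawNormal b i := rfl

lemma mem_facetVertices (i : Fin (n + 2)) (j : Fin (n + 1)) :
    b (i.succAbove j) ∈ (facetVertices b i : Set (E (n + 1))) := by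
  rw [coe_facetVertices]
  exact ⟨j, rfl⟩

lemma inner_rawNormal_eq_zero {i : Fin (n + 2)} {w : E (n + 1)}
    (hw : w ∈ vectorSpan ℝ (facetVertices b i : Set (E (n + 1)))) :
    inner ℝ w (rawNormal b i) = 0 :=
  (Submodule.mem_orthogonal _ _).1 (Submodule.starProjection_apply_mem _ _) w hw

/-- The centroid of the cell is the weighted mean of `b i` and the facet centroid with weights `1`
and `n + 1`. This links the centroid definition of the normal to the opposite vertex. -/
lemma centroid_sub_centroid (i : Fin (n + 2)) :
    ((n : ℝ) + 2) • ((facetVertices b i).centroid ℝ id - (vertices b).centroid ℝ id) =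
      (facetVertices b i).centroid ℝ id - b i := by
  have hF : (facetVertices b i).Nonempty := by simp [facetVertices]
  have hK : (vertices b).Nonempty := by simp [vertices]
  have e1 : ((n : ℝ) + 2) • (vertices b).centroid ℝ id = ∑ j, b j := by
    rw [Finset.centroid_eq_centerMass _ hK, Finset.centerMass_eq_of_sum_1 _ _
      (Finset.sum_centroidWeights_eq_one_of_nonempty ℝ _ hK)]
    simp only [Finset.centroidWeights_apply, card_vertices, ← Finset.smul_sum, smul_smul]
    simp only [vertices, Finset.sum_map, Function.Embedding.coeFn_mk, id]
    push_cast
    rw [mul_inv_cancel₀ (by positivity), one_smul]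
  have e2 : ((n : ℝ) + 1) • (facetVertices b i).centroid ℝ id = ∑ j, b (i.succAbove j) := by
    have hc : (facetVertices b i).card = n + 1 := by simp [facetVertices]
    rw [Finset.centroid_eq_centerMass _ hF, Finset.centerMass_eq_of_sum_1 _ _
      (Finset.sum_centroidWeights_eq_one_of_nonempty ℝ _ hF)]
    simp only [Finset.centroidWeights_apply, hc, ← Finset.smul_sum, smul_smul]
    simp only [facetVertices, Finset.sum_map, Function.Embedding.coeFn_mk, id, Function.comp_apply]
    push_cast
    rw [mul_inv_cancel₀ (by positivity), one_smul]
  rw [Fin.sum_univ_succAbove _ i, ← e2] at e1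
  rw [smul_sub, e1]
  module

lemma centroid_sub_rawNormal_mem (i : Fin (n + 2)) :
    (facetVertices b i).centroid ℝ id - (vertices b).centroid ℝ id - rawNormal b i ∈
      vectorSpan ℝ (facetVertices b i : Set (E (n + 1))) := by
  have := Submodule.sub_starProjection_mem_orthogonal
    (K := (vectorSpan ℝ (facetVertices b i : Set (E (n + 1))))ᗮ)
    ((facetVertices b i).centroid ℝ id - (vertices b).centroid ℝ id)
  rwa [Submodule.orthogonal_orthogonal] at this

/-- Up to a vector tangent to the facet, `b (i.succAbove j) - b i` is `n + 2` times the difference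
of centroids, whose normal part is `rawNormal b i`. -/
lemma inner_rawNormal_opposite (i : Fin (n + 2)) (j : Fin (n + 1)) :
    inner ℝ (b (i.succAbove j) - b i) (rawNormal b i) = ((n : ℝ) + 2) * ‖rawNormal b i‖ ^ 2 := by
  have hF : (facetVertices b i).Nonempty := by simp [facetVertices]
  have hc : b (i.succAbove j) - (facetVertices b i).centroid ℝ id ∈
      vectorSpan ℝ (facetVertices b i : Set (E (n + 1))) := by
    rw [← direction_affineSpan]
    refine AffineSubspace.vsub_mem_direction (mem_affineSpan ℝ (mem_facetVertices b i j)) ?_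
    exact convexHull_subset_affineSpan _ (Finset.centroid_mem_convexHull _ hF)
  have hd : b (i.succAbove j) - b i = (b (i.succAbove j) - (facetVertices b i).centroid ℝ id) +
      ((n : ℝ) + 2) • ((facetVertices b i).centroid ℝ id - (vertices b).centroid ℝ id) := by
    rw [centroid_sub_centroid]
    abel
  rw [hd, inner_add_left, inner_rawNormal_eq_zero b hc, zero_add, real_inner_smul_left]
  congr 1
  rw [← real_inner_self_eq_norm_sq, ← sub_eq_zero, ← inner_sub_left,
    inner_rawNormal_eq_zero b (centroid_sub_rawNormal_mem b i)]

lemma coord_linear_eq_zero {i : Fin (n + 2)} {w : E (n + 1)}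
    (hw : w ∈ vectorSpan ℝ (facetVertices b i : Set (E (n + 1)))) :
    (b.coord i).linear w = 0 := by
  have : vectorSpan ℝ (facetVertices b i : Set (E (n + 1))) ≤ LinearMap.ker (b.coord i).linear := by
    rw [vectorSpan, Submodule.span_le]
    rintro _ ⟨x, hx, y, hy, rfl⟩
    rw [coe_facetVertices] at hx hy
    obtain ⟨j, rfl⟩ := hx
    obtain ⟨l, rfl⟩ := hy
    rw [SetLike.mem_coe, LinearMap.mem_ker]
    refine (coord_linear_sub b i _ _).trans ?_
    rw [Function.comp_apply, Function.comp_apply, b.coord_apply_ne (Fin.succAbove_ne i _).symm,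
      b.coord_apply_ne (Fin.succAbove_ne i _).symm, sub_zero]
  exact this hw

/-- The linear part of `b.coord i` kills tangent vectors, so `rawNormal` may be replaced by the
difference of centroids. Scaled by `n + 2`, this leads from `b i`, where the coordinate is `1`, to
the facet, where it is `0`. -/
lemma coord_linear_rawNormal (i : Fin (n + 2)) :
    ((n : ℝ) + 2) * (b.coord i).linear (rawNormal b i) = -1 := by
  have h2 := coord_linear_eq_zero b (centroid_sub_rawNormal_mem b i)
  rw [map_sub, sub_eq_zero] at h2
  have hF : (facetVertices b i).Nonempty := by simp [facetVertices]
  rw [← h2, ← smul_eq_mul, ← map_smul, centroid_sub_centroid, coord_linear_sub,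
    b.coord_apply_eq]
  have hmem : (facetVertices b i).centroid ℝ id ∈ simplex (facetVertices b i) :=
    Finset.centroid_mem_convexHull _ hF
  rw [(exists_of_mem_facet b hmem).1, zero_sub]

/-- The coordinate drops by `1` along `(n + 2) • rawNormal b i` while its slope is at most `(2 *
r)⁻¹`. In particular the raw normal is nonzero. -/
lemma le_norm_rawNormal {x : E (n + 1)} {r : ℝ} (hr : 0 < r)
    (hball : Metric.closedBall x r ⊆ simplex (vertices b)) (i : Fin (n + 2)) :
    2 * r ≤ ((n : ℝ) + 2) * ‖rawNormal b i‖ := by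
  have h := abs_coord_linear_le b hr hball i (rawNormal b i)
  have h1 : |((n : ℝ) + 2) * (b.coord i).linear (rawNormal b i)| = 1 := by
    rw [coord_linear_rawNormal]; simp
  rw [abs_mul, abs_of_pos (by positivity)] at h1
  rw [← div_eq_inv_mul, le_div_iff₀ (by positivity)] at h
  calc 2 * r = ((n : ℝ) + 2) * (|(b.coord i).linear (rawNormal b i)| * (2 * r)) := by
        rw [← mul_assoc, h1, one_mul]
    _ ≤ _ := by gcongr

lemma inner_normal_eq_zero {l i j : Fin (n + 2)} (hi : i ≠ l) (hj : j ≠ l) :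
    inner ℝ (b j - b i) (normal (vertices b) (facetVertices b l)) = 0 := by
  obtain ⟨i, rfl⟩ := Fin.exists_succAbove_eq hi
  obtain ⟨j, rfl⟩ := Fin.exists_succAbove_eq hj
  rw [normal_eq, real_inner_smul_right, inner_rawNormal_eq_zero, mul_zero]
  exact vsub_mem_vectorSpan ℝ (mem_facetVertices b l j) (mem_facetVertices b l i)

/-- The distance of the `i`-th vertex from the opposite facet. -/
noncomputable def height (i : Fin (n + 2)) : ℝ := ((n : ℝ) + 2) * ‖rawNormal b i‖

lemma inner_normal_opposite (i : Fin (n + 2)) (j : Fin (n + 1)) :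
    inner ℝ (b (i.succAbove j) - b i) (normal (vertices b) (facetVertices b i)) = height b i := by
  rw [normal_eq, real_inner_smul_right, inner_rawNormal_opposite, height]
  rcases eq_or_ne ‖rawNormal b i‖ 0 with h | h
  · simp [h]
  · field_simp

lemma norm_normal_le (i : Fin (n + 2)) : ‖normal (vertices b) (facetVertices b i)‖ ≤ 1 := by
  rw [normal_eq, norm_smul, norm_inv, norm_norm]
  exact inv_mul_le_one

end HDG

/-! ### Polynomial fields with prescribed normal components -/

namespace HDG

open scoped ENNReal NNReal

section Poly

variable {d : ℕ}

lemma IsPoly.const (k : ℕ) (a : ℝ) : IsPoly k (fun _ : E d => a) :=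
  ⟨MvPolynomial.C a, by simp, by simp⟩

lemma IsPoly.add {k : ℕ} {f g : E d → ℝ} (hf : IsPoly k f) (hg : IsPoly k g) :
    IsPoly k (fun x => f x + g x) := by
  obtain ⟨p, hp, hf⟩ := hf
  obtain ⟨q, hq, hg⟩ := hg
  exact ⟨p + q, (MvPolynomial.totalDegree_add p q).trans (max_le hp hq), fun x => by simp [hf, hg]⟩

lemma IsPoly.mul {k l : ℕ} {f g : E d → ℝ} (hf : IsPoly k f) (hg : IsPoly l g) :
    IsPoly (k + l) (fun x => f x * g x) := by
  obtain ⟨p, hp, hf⟩ := hf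
  obtain ⟨q, hq, hg⟩ := hg
  exact ⟨p * q, (MvPolynomial.totalDegree_mul p q).trans (add_le_add hp hq),
    fun x => by simp [hf, hg]⟩

lemma IsPoly.const_mul {k : ℕ} {f : E d → ℝ} (a : ℝ) (hf : IsPoly k f) :
    IsPoly k (fun x => a * f x) := by
  simpa using (IsPoly.const 0 a).mul hf

lemma IsPoly.sum {ι : Type*} {k : ℕ} (s : Finset ι) {f : ι → E d → ℝ}
    (hf : ∀ i ∈ s, IsPoly k (f i)) : IsPoly k (fun x => ∑ i ∈ s, f i x) := by
  classical
  induction s using Finset.induction_on with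
  | empty => simpa using IsPoly.const k 0
  | insert a s ha ih =>
    simp only [Finset.sum_insert ha]
    exact (hf a (Finset.mem_insert_self a s)).add
      (ih fun i hi => hf i (Finset.mem_insert_of_mem hi))

lemma IsPoly.pow {k : ℕ} {f : E d → ℝ} (hf : IsPoly k f) (m : ℕ) :
    IsPoly (k * m) (fun x => f x ^ m) := by
  induction m with
  | zero => simpa using IsPoly.const 0 1
  | succ m ih =>
    simp only [pow_succ]
    exact ih.mul hf

lemma IsPoly.prod {ι : Type*} (s : Finset ι) {k : ι → ℕ} {f : ι → E d → ℝ}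
    (hf : ∀ i ∈ s, IsPoly (k i) (f i)) : IsPoly (∑ i ∈ s, k i) (fun x => ∏ i ∈ s, f i x) := by
  classical
  induction s using Finset.induction_on with
  | empty => simpa using IsPoly.const 0 1
  | insert a s ha ih =>
    simp only [Finset.prod_insert ha, Finset.sum_insert ha]
    exact (hf a (Finset.mem_insert_self a s)).mul
      (ih fun i hi => hf i (Finset.mem_insert_of_mem hi))

lemma isPoly_apply (l : Fin d) : IsPoly 1 (fun x : E d => x l) :=
  ⟨MvPolynomial.X l, by simp, by simp⟩

lemma isPoly_affineMap (f : E d →ᵃ[ℝ] ℝ) : IsPoly 1 f := by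
  have h : (f : E d → ℝ) =
      fun x => f 0 + ∑ l, f.linear (EuclideanSpace.single l 1) * x l := by
    funext x
    have h1 := f.linearMap_vsub x 0
    rw [vsub_eq_sub, sub_zero, vsub_eq_sub] at h1
    have h2 : x = ∑ l, x l • EuclideanSpace.single l (1 : ℝ) := by
      have := (EuclideanSpace.basisFun (Fin d) ℝ).sum_repr x
      simpa using this.symm
    have h3 : f.linear x = ∑ l, f.linear (EuclideanSpace.single l 1) * x l := by
      conv_lhs => rw [h2, map_sum]
      exact Finset.sum_congr rfl fun l _ => by rw [map_smul, smul_eq_mul, mul_comm]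
    rw [← h3, h1]
    ring
  rw [h]
  exact (IsPoly.const 1 _).add (IsPoly.sum _ fun l _ => (isPoly_apply l).const_mul _)

lemma IsPoly.mon {n : ℕ} {f : Fin n → E d → ℝ} (hf : ∀ j, IsPoly 1 (f j)) (m : Fin n →₀ ℕ) :
    IsPoly (∑ j, m j) (fun x => mon m (fun j => f j x)) :=
  IsPoly.prod _ fun j _ => by simpa using (hf j).pow (m j)

lemma IsPoly.continuous {k : ℕ} {f : E d → ℝ} (hf : IsPoly k f) : Continuous f := by
  obtain ⟨p, -, hf⟩ := hf
  rw [funext hf]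
  exact (MvPolynomial.continuous_eval p).comp
    (continuous_pi fun i => (EuclideanSpace.proj (𝕜 := ℝ) i).continuous)

lemma IsVecPoly.continuous {k : ℕ} {f : E d → E d} (hf : IsVecPoly k f) : Continuous f :=
  (PiLp.continuous_toLp 2 _).comp (continuous_pi fun i => (hf i).continuous)

end Poly

/-- `f` is differentiable at `y`, its value there is at most one and its derivative at most `A`. -/
def BddDeriv {V : Type*} [NormedAddCommGroup V] [NormedSpace ℝ V] (f : V → ℝ) (y : V) (A : ℝ) :
    Prop := |f y| ≤ 1 ∧ ∃ D : V →L[ℝ] ℝ, HasFDerivAt f D y ∧ ‖D‖ ≤ A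

section BddDeriv

variable {V : Type*} [NormedAddCommGroup V] [NormedSpace ℝ V] {y : V}

lemma BddDeriv.one : BddDeriv (fun _ : V => (1 : ℝ)) y 0 :=
  ⟨by simp, 0, hasFDerivAt_const _ _, by simp⟩

/-- Both values are at most one, so the product rule simply adds the derivative bounds. A monomial
of degree `k` in the barycentric coordinates therefore costs only a factor `k`. -/
lemma BddDeriv.mul {f g : V → ℝ} {A B : ℝ} (hf : BddDeriv f y A) (hg : BddDeriv g y B) :
    BddDeriv (fun x => f x * g x) y (A + B) := by
  obtain ⟨hf1, D, hD, hDA⟩ := hf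
  obtain ⟨hg1, D', hD', hDB⟩ := hg
  refine ⟨?_, _, hD.mul hD', ?_⟩
  · rw [abs_mul]
    exact mul_le_one₀ hf1 (abs_nonneg _) hg1
  · refine (norm_add_le _ _).trans ?_
    rw [norm_smul, norm_smul, Real.norm_eq_abs, Real.norm_eq_abs, add_comm]
    refine add_le_add ?_ ?_
    · exact (mul_le_of_le_one_left (norm_nonneg _) hg1).trans hDA
    · exact (mul_le_of_le_one_left (norm_nonneg _) hf1).trans hDB

lemma BddDeriv.pow {f : V → ℝ} {A : ℝ} (hf : BddDeriv f y A) (m : ℕ) :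
    BddDeriv (fun x => f x ^ m) y (m * A) := by
  induction m with
  | zero => simpa using BddDeriv.one
  | succ m ih =>
    simp only [pow_succ, Nat.cast_succ, add_mul, one_mul]
    exact ih.mul hf

lemma BddDeriv.mon {n : ℕ} {f : Fin n → V → ℝ} {A : ℝ} (hf : ∀ j, BddDeriv (f j) y A)
    (m : Fin n →₀ ℕ) : BddDeriv (fun x => mon m (fun j => f j x)) y ((∑ j, m j : ℕ) * A) := by
  classical
  have : ∀ s : Finset (Fin n),
      BddDeriv (fun x => ∏ j ∈ s, f j x ^ m j) y ((∑ j ∈ s, m j : ℕ) * A) := fun s => by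
    induction s using Finset.induction_on with
    | empty => simpa using BddDeriv.one
    | insert a s ha ih =>
      simp only [Finset.prod_insert ha, Finset.sum_insert ha, Nat.cast_add, add_mul]
      exact ((hf a).pow (m a)).mul (by simpa using ih)
  exact this Finset.univ

end BddDeriv

variable {n : ℕ} (b : AffineBasis (Fin (n + 2)) ℝ (E (n + 1)))

/-- The vector field on a cell whose normal component on the `i`-th facet is the homogeneous
polynomial with coefficients `c i`; each monomial is carried by an edge from the `i`-th vertex to a
vertex occurring in the monomial. -/
noncomputable def lifting (k : ℕ) (pivot : (Fin (n + 1) →₀ ℕ) → Fin (n + 1))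
    (c : Fin (n + 2) → (Fin (n + 1) →₀ ℕ) → ℝ) (y : E (n + 1)) : E (n + 1) :=
  ∑ i, ∑ m ∈ exps (n + 1) k,
    ((height b i)⁻¹ * c i m * mon m (fun j => b.coord (i.succAbove j) y)) •
      (b (i.succAbove (pivot m)) - b i)

variable {b} {k : ℕ} {pivot : (Fin (n + 1) →₀ ℕ) → Fin (n + 1)}
  {c : Fin (n + 2) → (Fin (n + 1) →₀ ℕ) → ℝ}

lemma isVecPoly_lifting : IsVecPoly k (lifting b k pivot c) := by
  intro l
  have : (fun y => lifting b k pivot c y l) = fun y => ∑ i, ∑ m ∈ exps (n + 1) k,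
      ((height b i)⁻¹ * c i m * (b (i.succAbove (pivot m)) - b i) l) *
        mon m (fun j => b.coord (i.succAbove j) y) := by
    funext y
    simp only [lifting, WithLp.ofLp_sum, Finset.sum_apply, PiLp.smul_apply, smul_eq_mul]
    exact Finset.sum_congr rfl fun i _ => Finset.sum_congr rfl fun m _ => by ring
  rw [this]
  refine IsPoly.sum _ fun i _ => IsPoly.sum _ fun m hm => IsPoly.const_mul _ ?_
  have := IsPoly.mon (fun j => isPoly_affineMap (b.coord (i.succAbove j))) m
  rwa [degree_of_mem_exps hm] at this

/-- A term belonging to another facet `i` contributes nothing on facet `l`. If its edge ends at `b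
l`, its monomial contains the coordinate of `b l`, which is zero there; otherwise both ends of the
edge lie in facet `l` and the edge is tangential. For `i = l` the factor `(height b l)⁻¹` normalizes
the edge. -/
lemma inner_lifting_normal (hpivot : ∀ m ∈ exps (n + 1) k, m (pivot m) ≠ 0)
    {l : Fin (n + 2)} (hl : height b l ≠ 0) {y : E (n + 1)}
    (hy : y ∈ simplex (facetVertices b l)) :
    inner ℝ (lifting b k pivot c y) (normal (vertices b) (facetVertices b l)) =
      hpoly k (c l) (fun j => b.coord (l.succAbove j) y) := by
  have hy0 := (exists_of_mem_facet b hy).1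
  simp only [lifting, sum_inner, real_inner_smul_left]
  rw [Finset.sum_eq_single l]
  · refine Finset.sum_congr rfl fun m _ => ?_
    rw [inner_normal_opposite]
    field_simp
  · intro i _ hil
    refine Finset.sum_eq_zero fun m hm => ?_
    by_cases hj : i.succAbove (pivot m) = l
    · have : mon m (fun j => b.coord (i.succAbove j) y) = 0 :=
        Finset.prod_eq_zero (Finset.mem_univ (pivot m)) (by
          simp only [hj, hy0, zero_pow (hpivot m hm)])
      rw [this, mul_zero, zero_mul]
    · rw [inner_normal_eq_zero b hil hj, mul_zero]
  · simp

section Bounds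

variable {x : E (n + 1)} {r h M : ℝ}

lemma bddDeriv_coord (hr : 0 < r) (hball : Metric.closedBall x r ⊆ simplex (vertices b))
    {y : E (n + 1)} (hy : y ∈ simplex (vertices b)) (i : Fin (n + 2)) :
    BddDeriv (b.coord i) y (2 * r)⁻¹ := by
  rw [simplex_vertices] at hy
  have h01 := coord_mem_Icc b hy i
  refine ⟨by rw [abs_of_nonneg h01.1]; exact h01.2,
    LinearMap.toContinuousLinearMap (b.coord i).linear, ?_, ?_⟩
  · have h1 : (b.coord i : E (n + 1) → ℝ) =
        fun z => LinearMap.toContinuousLinearMap (b.coord i).linear z + b.coord i 0 := by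
      funext z
      have := coord_linear_sub b i z 0
      rw [sub_zero] at this
      rw [LinearMap.coe_toContinuousLinearMap', this]
      ring
    conv => enter [1]; rw [h1]
    exact (ContinuousLinearMap.hasFDerivAt _).add_const _
  · refine ContinuousLinearMap.opNorm_le_bound _ (by positivity) fun w => ?_
    exact abs_coord_linear_le b hr hball i w

/-- The edge contributes `h` and the inverse height `(2 * r)⁻¹`, so only the shape ratio remains. -/
lemma abs_coeff_mul_dist_le (hr : 0 < r) (hball : Metric.closedBall x r ⊆ simplex (vertices b))
    (hdist : ∀ i j, dist (b i) (b j) ≤ h) (hc : ∀ i, ∀ m ∈ exps (n + 1) k, |c i m| ≤ M)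
    (i : Fin (n + 2)) {m : Fin (n + 1) →₀ ℕ} (hm : m ∈ exps (n + 1) k) :
    |(height b i)⁻¹ * c i m| * ‖b (i.succAbove (pivot m)) - b i‖ ≤ M * (h * (2 * r)⁻¹) := by
  have hH : 2 * r ≤ height b i := le_norm_rawNormal b hr hball i
  have hH0 : 0 < height b i := lt_of_lt_of_le (by positivity) hH
  have hM : 0 ≤ M := (abs_nonneg _).trans (hc i m hm)
  have h0 : 0 ≤ h := dist_nonneg.trans (hdist 0 0)
  rw [abs_mul, abs_of_pos (inv_pos.2 hH0), ← dist_eq_norm]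
  calc (height b i)⁻¹ * |c i m| * dist (b (i.succAbove (pivot m))) (b i)
      ≤ (2 * r)⁻¹ * M * h := by
        gcongr
        · exact hc i m hm
        · exact hdist _ _
    _ = _ := by ring

lemma norm_lifting_le (hr : 0 < r) (hball : Metric.closedBall x r ⊆ simplex (vertices b))
    (hdist : ∀ i j, dist (b i) (b j) ≤ h) (hc : ∀ i, ∀ m ∈ exps (n + 1) k, |c i m| ≤ M)
    {y : E (n + 1)} (hy : y ∈ simplex (vertices b)) :
    ‖lifting b k pivot c y‖ ≤ (n + 2 : ℕ) * ((exps (n + 1) k).card * (M * (h * (2 * r)⁻¹))) := by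
  have h1 : ∀ i, ∀ m ∈ exps (n + 1) k,
      ‖((height b i)⁻¹ * c i m * mon m (fun j => b.coord (i.succAbove j) y)) •
        (b (i.succAbove (pivot m)) - b i)‖ ≤ M * (h * (2 * r)⁻¹) := by
    intro i m hm
    have h2 := (BddDeriv.mon (fun j => bddDeriv_coord hr hball hy (i.succAbove j)) m).1
    refine le_trans ?_ (abs_coeff_mul_dist_le (pivot := pivot) hr hball hdist hc i hm)
    rw [norm_smul, Real.norm_eq_abs, abs_mul]
    gcongr
    exact mul_le_of_le_one_right (abs_nonneg _) h2
  refine (norm_sum_le_of_le _ fun i _ => norm_sum_le_of_le _ (h1 i)).trans_eq ?_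
  simp

lemma norm_fderiv_lifting_le (hr : 0 < r)
    (hball : Metric.closedBall x r ⊆ simplex (vertices b))
    (hdist : ∀ i j, dist (b i) (b j) ≤ h) (hc : ∀ i, ∀ m ∈ exps (n + 1) k, |c i m| ≤ M)
    {y : E (n + 1)} (hy : y ∈ simplex (vertices b)) :
    ‖fderiv ℝ (lifting b k pivot c) y‖ ≤
      (n + 2 : ℕ) * ((exps (n + 1) k).card * (M * (h * (2 * r)⁻¹) * (k * (2 * r)⁻¹))) := by
  have h1 : ∀ (i : Fin (n + 2)) (m : Fin (n + 1) →₀ ℕ), BddDeriv (fun y => mon m (fun j => b.coord (i.succAbove j) y)) y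
      ((∑ j, m j : ℕ) * (2 * r)⁻¹) := fun i m =>
    BddDeriv.mon (fun j => bddDeriv_coord hr hball hy (i.succAbove j)) m
  choose _ D hD hDn using h1
  have h2 : HasFDerivAt (lifting b k pivot c) (∑ i, ∑ m ∈ exps (n + 1) k,
      (((height b i)⁻¹ * c i m) • D i m).smulRight (b (i.succAbove (pivot m)) - b i)) y := by
    unfold lifting
    refine HasFDerivAt.fun_sum fun i _ => HasFDerivAt.fun_sum fun m _ => ?_
    exact ((hD i m).const_mul ((height b i)⁻¹ * c i m)).smul_const _
  rw [h2.fderiv]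
  have h3 : ∀ i, ∀ m ∈ exps (n + 1) k,
      ‖(((height b i)⁻¹ * c i m) • D i m).smulRight (b (i.succAbove (pivot m)) - b i)‖ ≤
        M * (h * (2 * r)⁻¹) * (k * (2 * r)⁻¹) := by
    intro i m hm
    have h4 := abs_coeff_mul_dist_le (pivot := pivot) hr hball hdist hc i hm
    have h5 := hDn i m
    rw [degree_of_mem_exps hm] at h5
    rw [ContinuousLinearMap.norm_smulRight_apply, norm_smul, Real.norm_eq_abs, mul_right_comm]
    exact mul_le_mul h4 h5 (norm_nonneg _) ((by positivity : (0:ℝ) ≤ _).trans h4)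
  refine (norm_sum_le_of_le _ fun i _ => norm_sum_le_of_le _ (h3 i)).trans_eq ?_
  simp

end Bounds

end HDG

/-! ### Scaled bounds on a shape regular cell -/

namespace HDG

open scoped ENNReal NNReal

lemma gradSq_le {d : ℕ} (v : E d → E d) (x : E d) : gradSq v x ≤ d * ‖fderiv ℝ v x‖ ^ 2 := by
  have : ∀ j ∈ (Finset.univ : Finset (Fin d)),
      ‖fderiv ℝ v x (EuclideanSpace.single j 1)‖ ^ 2 ≤ ‖fderiv ℝ v x‖ ^ 2 := fun j _ => by
    have := (fderiv ℝ v x).le_opNorm (EuclideanSpace.single j (1 : ℝ))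
    simp only [PiLp.norm_single, norm_one, mul_one] at this
    gcongr
  refine (Finset.sum_le_sum this).trans_eq ?_
  simp

lemma gradSq_nonneg {d : ℕ} (v : E d → E d) (x : E d) : 0 ≤ gradSq v x :=
  Finset.sum_nonneg fun _ _ => sq_nonneg _

lemma isCompact_simplex {d : ℕ} (K : Finset (E d)) : IsCompact (simplex K) :=
  K.finite_toSet.isCompact_convexHull ℝ

lemma subset_simplex {d : ℕ} (K : Finset (E d)) : (K : Set (E d)) ⊆ simplex K :=
  subset_convexHull ℝ _

lemma dist_le_hK {d : ℕ} {K : Finset (E d)} {x y : E d} (hx : x ∈ simplex K)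
    (hy : y ∈ simplex K) : dist x y ≤ hK K :=
  Metric.dist_le_diam_of_mem (isCompact_simplex K).isBounded hx hy

/-- The volume of a cell is `O(h^d)`. -/
lemma volume_openCell_le {d : ℕ} {K : Finset (E d)} (hne : K.Nonempty) :
    volume.real (openCell K) ≤ hK K ^ d * volume.real (Metric.ball (0 : E d) 1) := by
  obtain ⟨a, ha⟩ := hne
  have hsub : openCell K ⊆ Metric.closedBall a (hK K) := fun y hy =>
    dist_le_hK (interior_subset hy) (subset_simplex K ha)
  have h := Measure.addHaar_real_closedBall (volume : Measure (E d)) a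
    (Metric.diam_nonneg : 0 ≤ hK K)
  rw [finrank_euclideanSpace_fin] at h
  exact (measureReal_mono hsub measure_closedBall_lt_top.ne).trans h.le

/-- The coefficients of a polynomial on a facet are controlled by its `L²` norm there. -/
lemma exists_coeff_sq_le_facet (n k : ℕ) {σ : ℝ} (hσ : 0 < σ) : ∃ B > 0,
    ∀ (b : AffineBasis (Fin (n + 2)) ℝ (E (n + 1))) (x : E (n + 1)) (r : ℝ), 0 < r →
      Metric.closedBall x r ⊆ simplex (vertices b) →
      0 < hK (vertices b) → hK (vertices b) ≤ σ * (2 * r) →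
      ∀ (i : Fin (n + 2)) (f : E (n + 1) → ℝ), IsPoly k f →
      ∃ c : (Fin (n + 1) →₀ ℕ) → ℝ,
        (∀ y ∈ simplex (facetVertices b i),
          f y = hpoly k c (fun j => b.coord (i.succAbove j) y)) ∧
        ∀ m ∈ exps (n + 1) k, hK (vertices b) ^ n * c m ^ 2 ≤
          B * ∫ y in simplex (facetVertices b i), f y ^ 2 ∂(surf (n + 1)) := by
  obtain ⟨κ, hκ, hκc⟩ := exists_coeff_sq_le_integral n k
  have hA : 0 < (surfFactor n : ℝ) := surfFactor_pos n
  -- `κ⁻¹` comes from norm equivalence on the standard simplex. The rest comes from the change of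
  -- variables, whose factor `((2 * r)⁻¹) ^ n` is absorbed by `h_K ^ n` using shape regularity.
  refine ⟨κ⁻¹ * ((surfFactor n : ℝ)⁻¹ * σ ^ n), by positivity,
    fun b x r hr hball hh0 hh i f hf => ?_⟩
  obtain ⟨c, hc⟩ := hf.exists_hpoly (b ∘ i.succAbove)
  refine ⟨c, fun y hy => ?_, fun m hm => ?_⟩
  · obtain ⟨-, h1, h2⟩ := exists_of_mem_facet b hy
    conv_lhs => rw [← h2]
    exact hc _ h1
  have h1 := hκc c m hm
  have h2 := integral_refSimplex_le (antilipschitzWith_facetMap b hr hball i)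
    (g := fun y => f y ^ 2) (hf.continuous.pow 2) (fun y => sq_nonneg _)
  have h3 : ∀ u, f (facetMap (b ∘ i.succAbove) u) = hpoly k c (bary u) := fun u =>
    hc _ (sum_bary u)
  simp only [h3] at h2
  rw [Real.coe_toNNReal _ (by positivity), ← simplex_facetVertices] at h2
  have hI : 0 ≤ ∫ y in simplex (facetVertices b i), f y ^ 2 ∂(surf (n + 1)) :=
    integral_nonneg fun _ => sq_nonneg _
  have h4 : hK (vertices b) ^ n * ((2 * r)⁻¹) ^ n ≤ σ ^ n := by
    rw [← mul_pow]
    gcongr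
    rw [← div_eq_mul_inv]
    exact (div_le_iff₀ (by positivity)).2 hh
  calc hK (vertices b) ^ n * c m ^ 2
      = κ⁻¹ * (hK (vertices b) ^ n * (κ * c m ^ 2)) := by field_simp
    _ ≤ κ⁻¹ * (hK (vertices b) ^ n * ((surfFactor n : ℝ)⁻¹ * ((2 * r)⁻¹) ^ n *
        ∫ y in simplex (facetVertices b i), f y ^ 2 ∂(surf (n + 1)))) := by
        have := h1.trans h2
        exact mul_le_mul_of_nonneg_left (mul_le_mul_of_nonneg_left this (by positivity))
          (by positivity)
    _ = κ⁻¹ * ((surfFactor n : ℝ)⁻¹ * (hK (vertices b) ^ n * ((2 * r)⁻¹) ^ n)) *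
        ∫ y in simplex (facetVertices b i), f y ^ 2 ∂(surf (n + 1)) := by ring
    _ ≤ _ := by gcongr

lemma integral_le_of_norm_le {X : Type*} [MeasurableSpace X] {μ : Measure X} {s : Set X}
    {f : X → ℝ} {A : ℝ} (hs : μ s < ∞) (hf0 : ∀ x ∈ s, 0 ≤ f x) (hf : ∀ x ∈ s, f x ≤ A) :
    ∫ x in s, f x ∂μ ≤ A * μ.real s :=
  (Real.le_norm_self _).trans (norm_setIntegral_le_of_norm_le_const hs fun x hx => by
    rw [Real.norm_eq_abs, abs_of_nonneg (hf0 x hx)]; exact hf x hx)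

/-- Polynomials on the facets of a shape regular cell are the normal components of a polynomial
vector field of the same degree, with the scaling of the norms that a similarity would give. -/
theorem exists_local_lifting (n k : ℕ) (hk : 1 ≤ k) {σ : ℝ} (hσ : 0 < σ) : ∃ C > 0,
    ∀ (b : AffineBasis (Fin (n + 2)) ℝ (E (n + 1))) (x : E (n + 1)) (r : ℝ), 0 < r →
      Metric.closedBall x r ⊆ simplex (vertices b) →
      0 < hK (vertices b) → hK (vertices b) ≤ σ * (2 * r) →
      ∀ p : Fin (n + 2) → E (n + 1) → ℝ, (∀ i, IsPoly k (p i)) →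
      ∃ v : E (n + 1) → E (n + 1), IsVecPoly k v ∧
        (∀ i, ∀ y ∈ simplex (facetVertices b i),
          inner ℝ (v y) (normal (vertices b) (facetVertices b i)) = hK (vertices b) * p i y) ∧
        ∫ y in openCell (vertices b), gradSq v y ≤ C * (hK (vertices b) *
          ∑ i, ∫ y in simplex (facetVertices b i), p i y ^ 2 ∂(surf (n + 1))) ∧
        (hK (vertices b))⁻¹ *
            ∑ i, ∫ y in simplex (facetVertices b i), ‖v y‖ ^ 2 ∂(surf (n + 1)) ≤
          C * (hK (vertices b) *
            ∑ i, ∫ y in simplex (facetVertices b i), p i y ^ 2 ∂(surf (n + 1))) := by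
  obtain ⟨B, hB, hBc⟩ := exists_coeff_sq_le_facet n k hσ
  obtain ⟨A, hA, hAs⟩ := exists_surf_real_le n
  set ω := volume.real (Metric.ball (0 : E (n + 1)) 1)
  set N : ℝ := (n + 2 : ℕ) * (exps (n + 1) k).card with hN
  have hω : 0 ≤ ω := measureReal_nonneg
  set C₁ : ℝ := (n + 1 : ℕ) * (N * (σ * (k * σ))) ^ 2 * ω * B with hC₁
  set C₂ : ℝ := (n + 2 : ℕ) * ((N * σ) ^ 2 * A) * B with hC₂
  have hC₁0 : 0 ≤ C₁ := by positivity
  have hC₂0 : 0 ≤ C₂ := by positivity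
  refine ⟨C₁ + C₂ + 1, by positivity, fun b x r hr hball hh0 hh p hp => ?_⟩
  set h := hK (vertices b) with hh'
  set S := ∑ i, ∫ y in simplex (facetVertices b i), p i y ^ 2 ∂(surf (n + 1)) with hS
  have hI : ∀ i, 0 ≤ ∫ y in simplex (facetVertices b i), p i y ^ 2 ∂(surf (n + 1)) := fun i =>
    integral_nonneg fun _ => sq_nonneg _
  have hS0 : 0 ≤ S := Finset.sum_nonneg fun i _ => hI i
  choose c hc1 hc2 using fun i => hBc b x r hr hball hh0 hh i (p i) (hp i)
  -- Here `k ≥ 1` enters: a monomial of degree zero has no variable to choose.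
  have hpiv : ∀ m : Fin (n + 1) →₀ ℕ, ∃ j, m ∈ exps (n + 1) k → m j ≠ 0 := fun m => by
    by_contra! hcon
    have hm := degree_of_mem_exps (hcon 0).1
    rw [Finset.sum_eq_zero fun j _ => (hcon j).2] at hm
    omega
  choose pivot hpivot using hpiv
  -- A common bound for the coefficients of all the `p i`, chosen so that `M ^ 2 * h ^ n = B * S`.
  set M := Real.sqrt (B * S / h ^ n) with hM
  have hM2 : M ^ 2 * h ^ n = B * S := by
    rw [hM, Real.sq_sqrt (by positivity)]
    field_simp
  have hcM : ∀ i, ∀ m ∈ exps (n + 1) k, |h * c i m| ≤ h * M := by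
    intro i m hm
    rw [abs_mul, abs_of_pos hh0]
    gcongr
    refine Real.abs_le_sqrt ?_
    rw [le_div_iff₀ (by positivity), mul_comm]
    refine (hc2 i m hm).trans ?_
    gcongr
    exact Finset.single_le_sum (fun i _ => hI i) (Finset.mem_univ i)
  have hmem : ∀ i, b i ∈ simplex (vertices b) := fun i =>
    subset_simplex _ (by rw [coe_vertices]; exact ⟨i, rfl⟩)
  have hdist : ∀ i j, dist (b i) (b j) ≤ h := fun i j => dist_le_hK (hmem i) (hmem j)
  have hratio : h * (2 * r)⁻¹ ≤ σ := by
    rw [← div_eq_mul_inv]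
    exact (div_le_iff₀ (by positivity)).2 hh
  have hM0 : 0 ≤ M := Real.sqrt_nonneg _
  -- The extra factor `h` in the coefficients makes the normal components `h * p i`.
  set v := lifting b k pivot (fun i m => h * c i m) with hv
  have hv1 : ∀ y ∈ simplex (vertices b), ‖v y‖ ≤ N * σ * (h * M) := fun y hy => by
    refine (norm_lifting_le hr hball hdist hcM hy).trans ?_
    calc (n + 2 : ℕ) * ((exps (n + 1) k).card * (h * M * (h * (2 * r)⁻¹)))
        = N * (h * (2 * r)⁻¹) * (h * M) := by rw [hN]; ring
      _ ≤ _ := by gcongr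
  have hv2 : ∀ y ∈ simplex (vertices b), ‖fderiv ℝ v y‖ ≤ N * (σ * (k * σ)) * M := fun y hy => by
    refine (norm_fderiv_lifting_le hr hball hdist hcM hy).trans ?_
    calc (n + 2 : ℕ) * ((exps (n + 1) k).card *
          (h * M * (h * (2 * r)⁻¹) * (k * (2 * r)⁻¹)))
        = N * ((h * (2 * r)⁻¹) * (k * (h * (2 * r)⁻¹))) * M := by rw [hN]; ring
      _ ≤ _ := by gcongr
  refine ⟨v, isVecPoly_lifting, fun i y hy => ?_, ?_, ?_⟩
  · have hH : height b i ≠ 0 :=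
      (lt_of_lt_of_le (by positivity) (le_norm_rawNormal b hr hball i)).ne'
    rw [hv, inner_lifting_normal (fun m hm => hpivot m hm) hH hy, hc1 i y hy, hpoly, hpoly,
      Finset.mul_sum]
    exact Finset.sum_congr rfl fun m _ => by ring
  · have hvol := volume_openCell_le (K := vertices b) (by simp [vertices])
    have hfin : volume (openCell (vertices b)) < ∞ :=
      (measure_mono interior_subset).trans_lt (isCompact_simplex _).measure_lt_top
    -- The gradient is `O(M)` and the volume `O(h ^ (n + 1))`, which leaves `h * (M ^ 2 * h ^ n)`.
    calc ∫ y in openCell (vertices b), gradSq v y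
        ≤ (n + 1 : ℕ) * (N * (σ * (k * σ)) * M) ^ 2 * volume.real (openCell (vertices b)) := by
          refine integral_le_of_norm_le hfin (fun y _ => gradSq_nonneg v y) fun y hy => ?_
          refine (gradSq_le v y).trans ?_
          gcongr
          exact hv2 y (interior_subset hy)
      _ ≤ (n + 1 : ℕ) * (N * (σ * (k * σ)) * M) ^ 2 * (h ^ (n + 1) * ω) := by gcongr
      _ = (n + 1 : ℕ) * (N * (σ * (k * σ))) ^ 2 * ω * h * (M ^ 2 * h ^ n) := by ring
      _ = C₁ * (h * S) := by rw [hM2, hC₁]; ring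
      _ ≤ _ := by gcongr; linarith
  · have hintg : ∀ i, ∫ y in simplex (facetVertices b i), ‖v y‖ ^ 2 ∂(surf (n + 1)) ≤
        (N * σ * (h * M)) ^ 2 * (A * h ^ n) := fun i => by
      have hfin : surf (n + 1) (simplex (facetVertices b i)) < ∞ := by
        rw [simplex_facetVertices]
        exact surf_convexHull_lt_top _
      refine (integral_le_of_norm_le (A := (N * σ * (h * M)) ^ 2) hfin
        (fun y _ => sq_nonneg _) fun y hy => ?_).trans ?_
      · have := hv1 y (facet_subset_cell b i hy)
        gcongr
      · gcongr
        rw [simplex_facetVertices]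
        exact hAs _ h fun i j => hdist _ _
    -- The weight gives `h⁻¹`, the field `(h * M) ^ 2` and the facet `h ^ n`: again `h * (M ^ 2 * h
    -- ^ n)`.
    calc h⁻¹ * ∑ i, ∫ y in simplex (facetVertices b i), ‖v y‖ ^ 2 ∂(surf (n + 1))
        ≤ h⁻¹ * ∑ i : Fin (n + 2), (N * σ * (h * M)) ^ 2 * (A * h ^ n) := by
          gcongr with i
          exact hintg i
      _ = h⁻¹ * h * h * ((n + 2 : ℕ) * ((N * σ) ^ 2 * A)) * (M ^ 2 * h ^ n) := by
          rw [Finset.sum_const, Finset.card_univ, Fintype.card_fin, nsmul_eq_mul]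
          ring
      _ = C₂ * (h * S) := by
          rw [hM2, hC₂, inv_mul_cancel₀ hh0.ne']
          ring
      _ ≤ _ := by gcongr; linarith

end HDG

/-! ### From affine bases to the cells of a triangulation; traces and gluing -/

namespace HDG

open scoped ENNReal NNReal

lemma exists_affineBasis_vertices {n : ℕ} {K : Finset (E (n + 1))} (hcard : K.card = n + 2)
    (hind : AffineIndependent ℝ ((↑) : K → E (n + 1))) :
    ∃ b : AffineBasis (Fin (n + 2)) ℝ (E (n + 1)), vertices b = K := by
  let e : Fin (n + 2) ≃ K := (K.equivFinOfCardEq hcard).symm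
  have hi : AffineIndependent ℝ (fun i => (e i : E (n + 1))) := hind.comp_embedding e.toEmbedding
  have ht : affineSpan ℝ (Set.range fun i => (e i : E (n + 1))) = ⊤ :=
    hi.affineSpan_eq_top_iff_card_eq_finrank_add_one.2 (by simp)
  refine ⟨⟨fun i => e i, hi, ht⟩, ?_⟩
  rw [← Finset.coe_inj, coe_vertices]
  change Set.range (Subtype.val ∘ e) = _
  rw [e.surjective.range_comp]
  simp

lemma measurableSet_simplex {d : ℕ} (K : Finset (E d)) : MeasurableSet (simplex K) :=
  (isCompact_simplex K).measurableSet

lemma boundaryIntegral_congr_ae {d : ℕ} {K : Finset (E d)} {g g' : Finset (E d) → E d → ℝ}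
    (h : ∀ F ∈ cellFacets K, g F =ᵐ[(surf d).restrict (simplex F)] g' F) :
    boundaryIntegral K g = boundaryIntegral K g' :=
  Finset.sum_congr rfl fun F hF => integral_congr_ae (h F hF)

lemma boundaryIntegral_congr {d : ℕ} {K : Finset (E d)} {g g' : Finset (E d) → E d → ℝ}
    (h : ∀ F ∈ cellFacets K, ∀ x ∈ simplex F, g F x = g' F x) :
    boundaryIntegral K g = boundaryIntegral K g' :=
  boundaryIntegral_congr_ae fun F hF =>
    ae_restrict_of_forall_mem (measurableSet_simplex F) (h F hF)

lemma boundaryIntegral_const_mul {d : ℕ} (K : Finset (E d)) (a : ℝ)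
    (g : Finset (E d) → E d → ℝ) :
    boundaryIntegral K (fun F x => a * g F x) = a * boundaryIntegral K g := by
  simp only [boundaryIntegral, integral_const_mul, Finset.mul_sum]

lemma boundaryIntegral_nonneg {d : ℕ} {K : Finset (E d)} {g : Finset (E d) → E d → ℝ}
    (h : ∀ F x, 0 ≤ g F x) : 0 ≤ boundaryIntegral K g :=
  Finset.sum_nonneg fun F _ => integral_nonneg (h F)

lemma boundaryIntegral_vertices {n : ℕ} (b : AffineBasis (Fin (n + 2)) ℝ (E (n + 1)))
    (g : Finset (E (n + 1)) → E (n + 1) → ℝ) :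
    boundaryIntegral (vertices b) g =
      ∑ i, ∫ x in simplex (facetVertices b i), g (facetVertices b i) x ∂(surf (n + 1)) := by
  simp [boundaryIntegral, cellFacets_vertices]

lemma mem_cellFacets_vertices {n : ℕ} (b : AffineBasis (Fin (n + 2)) ℝ (E (n + 1)))
    {F : Finset (E (n + 1))} : F ∈ cellFacets (vertices b) ↔ ∃ i, facetVertices b i = F := by
  simp [cellFacets_vertices]

lemma hK_vertices_pos {n : ℕ} (b : AffineBasis (Fin (n + 2)) ℝ (E (n + 1))) :
    0 < hK (vertices b) := by
  have hmem : ∀ i, b i ∈ simplex (vertices b) := fun i =>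
    subset_simplex _ (by rw [coe_vertices]; exact ⟨i, rfl⟩)
  refine lt_of_lt_of_le (dist_pos.2 fun h => ?_) (dist_le_hK (hmem 0) (hmem 1))
  exact absurd (b.ind.injective h) (by simp)

/-- A simplex with `d + 1` affinely independent vertices. -/
def IsCell {d : ℕ} (K : Finset (E d)) : Prop :=
  K.card = d + 1 ∧ AffineIndependent ℝ ((↑) : K → E d)

lemma IsCell.exists_basis {n : ℕ} {K : Finset (E (n + 1))} (hK : IsCell K) :
    ∃ b : AffineBasis (Fin (n + 2)) ℝ (E (n + 1)), vertices b = K :=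
  exists_affineBasis_vertices hK.1 hK.2

lemma IsCell.facet_subset {n : ℕ} {K F : Finset (E (n + 1))} (hF : F ∈ cellFacets K) :
    simplex F ⊆ simplex K :=
  convexHull_mono (by exact_mod_cast (Finset.mem_powersetCard.1 hF).1)

lemma IsCell.closure_openCell {n : ℕ} {K : Finset (E (n + 1))} (hK : IsCell K) :
    closure (openCell K) = simplex K := by
  obtain ⟨b, rfl⟩ := hK.exists_basis
  have hne : (interior (simplex (vertices b))).Nonempty := by
    rw [simplex_vertices]
    exact ⟨_, b.centroid_mem_interior_convexHull⟩
  exact (Convex.closure_interior_eq_closure_of_nonempty_interior (convex_convexHull ℝ _) hne).trans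
    (isCompact_simplex _).isClosed.closure_eq

/-- The open cell is dense in the closed one, so the extension by limits of `v` coincides with the
continuous `w`. -/
lemma IsCell.trace_eq {n : ℕ} {K : Finset (E (n + 1))} (hK : IsCell K)
    {v w : E (n + 1) → E (n + 1)} (hw : Continuous w) (h : Set.EqOn v w (openCell K))
    {x : E (n + 1)} (hx : x ∈ simplex K) : trace K v x = w x := by
  rw [← hK.closure_openCell] at hx
  refine extendFrom_eq hx ?_
  exact ((hw.tendsto x).mono_left nhdsWithin_le_nhds).congr'
    (h.symm.eventuallyEq_nhdsWithin)

/-- Polynomials on the facets of a shape regular cell are, up to the factor `h_K`, the normal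
components of a polynomial vector field of the same degree. -/
theorem exists_cell_lifting (n k : ℕ) (hk : 1 ≤ k) {σ : ℝ} (hσ : 0 < σ) : ∃ C > 0,
    ∀ K : Finset (E (n + 1)), IsCell K →
      (∃ (x : E (n + 1)) (r : ℝ),
        0 < r ∧ Metric.closedBall x r ⊆ simplex K ∧ hK K ≤ σ * (2 * r)) →
      ∀ p : Finset (E (n + 1)) → E (n + 1) → ℝ, (∀ F ∈ cellFacets K, IsPoly k (p F)) →
      ∃ v : E (n + 1) → E (n + 1), IsVecPoly k v ∧
        (∀ F ∈ cellFacets K, ∀ y ∈ simplex F, inner ℝ (v y) (normal K F) = hK K * p F y) ∧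
        ∫ y in openCell K, gradSq v y ≤
          C * (hK K * boundaryIntegral K (fun F y => p F y ^ 2)) ∧
        (hK K)⁻¹ * boundaryIntegral K (fun _ y => ‖v y‖ ^ 2) ≤
          C * (hK K * boundaryIntegral K (fun F y => p F y ^ 2)) ∧
        hK K * boundaryIntegral K (fun F y => p F y ^ 2) ≤
          (hK K)⁻¹ * boundaryIntegral K (fun _ y => ‖v y‖ ^ 2) := by
  obtain ⟨C, hC, hloc⟩ := exists_local_lifting n k hk hσ
  refine ⟨C, hC, fun K hcell ⟨x, r, hr, hball, hh⟩ p hp => ?_⟩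
  obtain ⟨b, rfl⟩ := hcell.exists_basis
  have hh0 := hK_vertices_pos b
  have hp' : ∀ i, IsPoly k (p (facetVertices b i)) := fun i =>
    hp _ ((mem_cellFacets_vertices b).2 ⟨i, rfl⟩)
  obtain ⟨v, hv, hn, h1, h2⟩ := hloc b x r hr hball hh0 hh (fun i => p (facetVertices b i)) hp'
  simp only [boundaryIntegral_vertices]
  refine ⟨v, hv, fun F hF => ?_, h1, h2, ?_⟩
  · obtain ⟨i, rfl⟩ := (mem_cellFacets_vertices b).1 hF
    exact hn i
  · set h := hK (vertices b)
    -- The reverse bound: a field is at least as large as its normal component, here `h * p`.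
    have hi : ∀ i, h ^ 2 * ∫ y in simplex (facetVertices b i),
        p (facetVertices b i) y ^ 2 ∂(surf (n + 1)) ≤
        ∫ y in simplex (facetVertices b i), ‖v y‖ ^ 2 ∂(surf (n + 1)) := fun i => by
      rw [← integral_const_mul]
      have hv' : Continuous fun y => ‖v y‖ ^ 2 := hv.continuous.norm.pow 2
      have hpc : Continuous fun y => h ^ 2 * p (facetVertices b i) y ^ 2 :=
        continuous_const.mul ((hp' i).continuous.pow 2)
      refine setIntegral_mono_on ?_ ?_ (measurableSet_simplex _) fun y hy => ?_
      · rw [simplex_facetVertices]; exact integrableOn_convexHull_surf _ hpc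
      · rw [simplex_facetVertices]; exact integrableOn_convexHull_surf _ hv'
      · rw [← mul_pow, ← hn i y hy, ← sq_abs]
        have : |inner ℝ (v y) (normal (vertices b) (facetVertices b i))| ≤ ‖v y‖ :=
          (abs_real_inner_le_norm _ _).trans
            (mul_le_of_le_one_right (norm_nonneg _) (norm_normal_le b i))
        gcongr
    rw [le_inv_mul_iff₀ hh0, ← mul_assoc, ← sq, Finset.mul_sum]
    exact Finset.sum_le_sum fun i _ => hi i

/-- The boundary of a shape regular cell has positive surface measure. -/
lemma IsCell.boundaryIntegral_one_pos {n : ℕ} {K : Finset (E (n + 1))} (hcell : IsCell K)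
    {x : E (n + 1)} {r : ℝ} (hr : 0 < r) (hball : Metric.closedBall x r ⊆ simplex K) :
    0 < boundaryIntegral K (fun _ _ => 1) := by
  obtain ⟨b, rfl⟩ := hcell.exists_basis
  have hh0 := hK_vertices_pos b
  -- The coefficient bound is applied to the constant `1` with `k = 0` and the cell's own shape
  -- ratio. If facet `0` were null, all coefficients of `1` would vanish.
  have hσ : 0 < hK (vertices b) / (2 * r) := by positivity
  obtain ⟨B, hB, h⟩ := exists_coeff_sq_le_facet n 0 hσ
  refine (boundaryIntegral_nonneg fun _ _ => zero_le_one).lt_of_ne fun h0 => ?_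
  rw [boundaryIntegral_vertices] at h0
  have h1 := (Finset.sum_eq_zero_iff_of_nonneg fun i _ =>
    integral_nonneg fun _ => zero_le_one).1 h0.symm 0 (Finset.mem_univ 0)
  obtain ⟨c, hc1, hc2⟩ := h b x r hr hball hh0 (by field_simp; rfl) 0 (fun _ => 1)
    (IsPoly.const 0 1)
  simp only [one_pow, h1, mul_zero] at hc2
  have hc0 : ∀ m ∈ exps (n + 1) 0, c m = 0 := fun m hm => by
    have h3 := hc2 m hm
    by_contra hne
    have : 0 < hK (vertices b) ^ n * c m ^ 2 := by positivity
    linarith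
  have h4 := hc1 (b ((0 : Fin (n + 2)).succAbove 0)) (subset_simplex _ (mem_facetVertices b 0 0))
  rw [hpoly, Finset.sum_eq_zero fun m hm => by rw [hc0 m hm, zero_mul]] at h4
  exact one_ne_zero h4

namespace Triangulation

variable {n : ℕ} {Ω : Set (E (n + 1))} (T : Triangulation (n + 1) Ω)

lemma mem_cells {K : Finset (E (n + 1))} :
    K ∈ T.cells ↔ K ∈ T.complex.faces ∧ K.card = n + 2 := by
  simp [cells]

lemma isCell {K : Finset (E (n + 1))} (hK : K ∈ T.cells) : IsCell K :=
  ⟨(T.mem_cells.1 hK).2, T.complex.indep (T.mem_cells.1 hK).1⟩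

lemma mem_facets {K F : Finset (E (n + 1))} (hK : K ∈ T.cells) (hF : F ∈ cellFacets K) :
    F ∈ T.facets := by
  have hF' := Finset.mem_powersetCard.1 hF
  rw [facets, Finset.mem_filter, Set.Finite.mem_toFinset]
  refine ⟨?_, K, hK, hF⟩
  refine T.complex.down_closed (T.mem_cells.1 hK).1 hF'.1 ?_
  rw [← Finset.card_pos, hF'.2]
  exact Nat.succ_pos n

lemma volume_convexHull_eq_zero {s : Finset (E (n + 1))} (hs : s.card ≤ n + 1) :
    volume (convexHull ℝ (s : Set (E (n + 1)))) = 0 := by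
  refine measure_mono_null (convexHull_subset_affineSpan _) (Measure.addHaar_affineSubspace _ _ ?_)
  intro htop
  rcases s.eq_empty_or_nonempty with rfl | hne
  · rw [Finset.coe_empty, AffineSubspace.span_empty] at htop
    exact AffineSubspace.bot_ne_top ℝ (E (n + 1)) (E (n + 1)) htop
  have h1 : vectorSpan ℝ (s : Set (E (n + 1))) = ⊤ := by
    rw [← direction_affineSpan, htop, AffineSubspace.direction_top]
  obtain ⟨m, hm⟩ : ∃ m, s.card = m + 1 := ⟨s.card - 1, by have := hne.card_pos; omega⟩
  have h2 := finrank_vectorSpan_image_finset_le ℝ (id : E (n + 1) → E (n + 1)) s hm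
  rw [Finset.image_id, h1, finrank_top, finrank_euclideanSpace_fin] at h2
  omega

/-- For distinct cells the intersection of the interiors is open, yet it lies in the hull of the
common vertices, at most `n + 1` of them, which is a null set. -/
lemma openCell_disjoint {K K' : Finset (E (n + 1))} (hK : K ∈ T.cells) (hK' : K' ∈ T.cells)
    {x : E (n + 1)} (hx : x ∈ openCell K) (hx' : x ∈ openCell K') : K = K' := by
  classical
  by_contra hne
  have hopen : IsOpen (openCell K ∩ openCell K') := isOpen_interior.inter isOpen_interior
  have hsub : openCell K ∩ openCell K' ⊆ convexHull ℝ ((K ∩ K' : Finset (E (n + 1))) : Set _) := by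
    rw [Finset.coe_inter]
    exact (Set.inter_subset_inter interior_subset interior_subset).trans
      (T.complex.inter_subset_convexHull (T.mem_cells.1 hK).1 (T.mem_cells.1 hK').1)
  have hcard : (K ∩ K').card ≤ n + 1 := by
    have h1 := (T.mem_cells.1 hK).2
    have h2 := (T.mem_cells.1 hK').2
    have h3 : K ∩ K' ⊂ K := by
      refine (Finset.inter_subset_left).ssubset_of_ne fun h => hne ?_
      exact Finset.eq_of_subset_of_card_le (Finset.inter_eq_left.1 h) (by omega)
    have := Finset.card_lt_card h3
    omega
  exact (hopen.measure_pos volume ⟨x, hx, hx'⟩).ne'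
    (measure_mono_null hsub (volume_convexHull_eq_zero hcard))

/-- Without cells, `Ω` would be covered by finitely many lower-dimensional simplices and so be null,
although it is open and nonempty. -/
lemma cells_nonempty (hΩ : IsOpen Ω) (hne : Ω.Nonempty) : T.cells.Nonempty := by
  by_contra hcon
  rw [Finset.not_nonempty_iff_eq_empty] at hcon
  refine (hΩ.measure_pos volume hne).ne' (measure_mono_null (subset_closure.trans_eq
    T.space_eq.symm) ?_)
  refine (measure_biUnion_null_iff T.finite_faces.countable).2 fun s hs => ?_
  refine volume_convexHull_eq_zero ?_
  have h1 : s.card ≤ n + 2 := by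
    have := (T.complex.indep hs).card_le_finrank_succ
    have h2 := Submodule.finrank_le (vectorSpan ℝ (Set.range ((↑) : s → E (n + 1))))
    rw [finrank_euclideanSpace_fin] at h2
    simp only [Fintype.card_coe] at this
    omega
  have h2 : s.card ≠ n + 2 := fun h => by
    have : s ∈ T.cells := T.mem_cells.2 ⟨hs, h⟩
    simp [hcon] at this
  omega

open Classical in
/-- The field that equals `w K` on each open cell `K`. -/
noncomputable def glue (w : Finset (E (n + 1)) → E (n + 1) → E (n + 1)) (x : E (n + 1)) :
    E (n + 1) :=
  if h : ∃ K ∈ T.cells, x ∈ openCell K then w h.choose x else 0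

lemma eqOn_glue (w : Finset (E (n + 1)) → E (n + 1) → E (n + 1)) {K : Finset (E (n + 1))}
    (hK : K ∈ T.cells) : Set.EqOn (T.glue w) (w K) (openCell K) := by
  intro x hx
  have h : ∃ K ∈ T.cells, x ∈ openCell K := ⟨K, hK, hx⟩
  rw [glue, dif_pos h, T.openCell_disjoint h.choose_spec.1 hK h.choose_spec.2 hx]

variable {T} {v : E (n + 1) → E (n + 1)} {w : Finset (E (n + 1)) → E (n + 1) → E (n + 1)}

lemma normV_eq (hw : ∀ K ∈ T.cells, Continuous (w K))
    (h : ∀ K ∈ T.cells, Set.EqOn v (w K) (openCell K)) (α : ℝ) :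
    T.normV α v 0 = Real.sqrt (∑ K ∈ T.cells, (∫ x in openCell K, gradSq (w K) x) +
      ∑ K ∈ T.cells, α * (hK K)⁻¹ * boundaryIntegral K (fun _ x => ‖w K x‖ ^ 2)) := by
  rw [normV]
  congr 2
  · refine Finset.sum_congr rfl fun K hK => ?_
    refine setIntegral_congr_fun isOpen_interior.measurableSet fun x hx => ?_
    have : v =ᶠ[nhds x] w K := (h K hK).eventuallyEq_of_mem (isOpen_interior.mem_nhds hx)
    simp only [gradSq, this.fderiv_eq]
  · refine Finset.sum_congr rfl fun K hK => ?_
    congr 1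
    refine boundaryIntegral_congr fun F hF x hx => ?_
    rw [(T.isCell hK).trace_eq (hw K hK) (h K hK) (IsCell.facet_subset hF hx), Pi.zero_apply,
      zero_sub, norm_neg]

lemma b2_eq (hw : ∀ K ∈ T.cells, Continuous (w K))
    (h : ∀ K ∈ T.cells, Set.EqOn v (w K) (openCell K)) (q : E (n + 1) → ℝ) :
    T.b2 q v = ∑ K ∈ T.cells,
      boundaryIntegral K (fun F x => inner ℝ (w K x) (normal K F) * q x) :=
  Finset.sum_congr rfl fun K hK => boundaryIntegral_congr fun F hF x hx => by
    rw [(T.isCell hK).trace_eq (hw K hK) (h K hK) (IsCell.facet_subset hF hx)]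

lemma zero_mem_Vbar (k : ℕ) : (0 : E (n + 1) → E (n + 1)) ∈ T.Vbar k :=
  ⟨fun _ _ => ⟨0, fun _ => IsPoly.const k 0, Filter.EventuallyEq.rfl⟩,
    fun _ _ _ => Filter.EventuallyEq.rfl⟩

end Triangulation

end HDG

/-! ### Global field and the inf-sup condition -/

namespace HDG

namespace Triangulation

variable {n : ℕ} {Ω : Set (E (n + 1))} {T : Triangulation (n + 1) Ω}

lemma hK_pos {K : Finset (E (n + 1))} (h : K ∈ T.cells) : 0 < hK K := by
  obtain ⟨b, rfl⟩ := (T.isCell h).exists_basis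
  exact hK_vertices_pos b

/-- Some admissible pair has a nonnegative quotient: a constant field or its negative. -/
lemma exists_quotient_nonneg (hne : T.cells.Nonempty) {σ : ℝ} (hT : T.ShapeRegular σ) (k : ℕ)
    {α : ℝ} (hα : 0 < α) (q : E (n + 1) → ℝ) :
    ∃ v ∈ T.Vh k, T.normV α v 0 ≠ 0 ∧ 0 ≤ T.b2 q v / T.normV α v 0 := by
  have hpoly : ∀ a : E (n + 1), IsVecPoly k (fun _ => a) := fun a i => IsPoly.const k (a i)
  have hb : ∀ a : E (n + 1), T.b2 q (fun _ => a) = ∑ K ∈ T.cells,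
      boundaryIntegral K (fun F x => inner ℝ a (normal K F) * q x) := fun a =>
    b2_eq (w := fun _ _ => a) (fun _ _ => continuous_const) (fun _ _ _ _ => rfl) q
  have hneg : ∀ a : E (n + 1), T.b2 q (fun _ => -a) = -T.b2 q (fun _ => a) := fun a => by
    rw [hb, hb, ← Finset.sum_neg_distrib]
    refine Finset.sum_congr rfl fun K _ => ?_
    rw [← neg_one_mul, ← boundaryIntegral_const_mul]
    simp only [inner_neg_left, neg_mul, one_mul]
  have hV : ∀ a : E (n + 1), ‖a‖ = 1 → T.normV α (fun _ => a) 0 ≠ 0 := fun a ha => by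
    rw [normV_eq (w := fun _ _ => a) (fun _ _ => continuous_const) (fun _ _ _ _ => rfl)]
    refine (Real.sqrt_pos.2 (add_pos_of_nonneg_of_pos ?_ ?_)).ne'
    · exact Finset.sum_nonneg fun K _ => integral_nonneg fun x => gradSq_nonneg _ x
    · refine Finset.sum_pos (fun K hK => ?_) hne
      obtain ⟨x, r, hr, hball, -⟩ := hT K hK
      have h1 := (T.isCell hK).boundaryIntegral_one_pos hr hball
      have h2 := hK_pos hK
      simp only [ha, one_pow]
      positivity
  have key : ∀ a : E (n + 1), ‖a‖ = 1 → 0 ≤ T.b2 q (fun _ => a) →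
      ∃ v ∈ T.Vh k, T.normV α v 0 ≠ 0 ∧ 0 ≤ T.b2 q v / T.normV α v 0 := fun a ha h0 =>
    ⟨fun _ => a, fun _ _ => ⟨_, hpoly a, fun _ _ => rfl⟩, hV a ha,
      div_nonneg h0 (Real.sqrt_nonneg _)⟩
  have he : ‖(EuclideanSpace.single 0 1 : E (n + 1))‖ = 1 := by simp
  rcases le_total 0 (T.b2 q fun _ => EuclideanSpace.single 0 1) with h | h
  · exact key _ he h
  · exact key _ ((norm_neg _).trans he) (by rw [hneg]; exact neg_nonneg.2 h)

/-- Gluing the liftings of the cells: the velocity field `v` satisfies `b₂(q, v) = ‖q‖_p²`, and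
`|||(v, 0)|||_v` is comparable with `‖q‖_p`. -/
theorem exists_global_lifting (n k : ℕ) (hk : 1 ≤ k) {α σ : ℝ} (hα : 0 < α) (hσ : 0 < σ) :
    ∃ C > 0, ∀ (Ω : Set (E (n + 1))) (T : Triangulation (n + 1) Ω), T.ShapeRegular σ →
      ∀ q ∈ T.Qbar k, ∃ v ∈ T.Vh k, T.b2 q v = T.normP q ^ 2 ∧
        T.normV α v 0 ^ 2 ≤ C * T.normP q ^ 2 ∧ α * T.normP q ^ 2 ≤ T.normV α v 0 ^ 2 := by
  classical
  obtain ⟨C, hC, hloc⟩ := exists_cell_lifting n k hk hσ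
  refine ⟨C + α * C, by positivity, fun Ω T hT q hq => ?_⟩
  -- The implication is placed inside the existential, with default `0` off the facets, so that
  -- `choose` yields a family indexed by all finite sets; the same is done for `w`.
  have hq' : ∀ F, ∃ p : E (n + 1) → ℝ, F ∈ T.facets →
      IsPoly k p ∧ q =ᵐ[(surf (n + 1)).restrict (simplex F)] p := fun F => by
    by_cases hF : F ∈ T.facets
    · obtain ⟨p, hp⟩ := hq F hF
      exact ⟨p, fun _ => hp⟩
    · exact ⟨0, fun h => absurd h hF⟩
  choose p hp using hq'
  have hw : ∀ K, ∃ w : E (n + 1) → E (n + 1), K ∈ T.cells → IsVecPoly k w ∧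
      (∀ F ∈ cellFacets K, ∀ y ∈ simplex F, inner ℝ (w y) (normal K F) = hK K * p F y) ∧
      ∫ y in openCell K, gradSq w y ≤
        C * (hK K * boundaryIntegral K (fun F y => p F y ^ 2)) ∧
      (hK K)⁻¹ * boundaryIntegral K (fun _ y => ‖w y‖ ^ 2) ≤
        C * (hK K * boundaryIntegral K (fun F y => p F y ^ 2)) ∧
      hK K * boundaryIntegral K (fun F y => p F y ^ 2) ≤
        (hK K)⁻¹ * boundaryIntegral K (fun _ y => ‖w y‖ ^ 2) := fun K => by
    by_cases hK : K ∈ T.cells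
    · obtain ⟨w, hw⟩ := hloc K (T.isCell hK) (hT K hK) p
        fun F hF => (hp F (T.mem_facets hK hF)).1
      exact ⟨w, fun _ => hw⟩
    · exact ⟨0, fun h => absurd h hK⟩
  choose w hw using hw
  have hcont : ∀ K ∈ T.cells, Continuous (w K) := fun K hK => (hw K hK).1.continuous
  have hglue : ∀ K ∈ T.cells, Set.EqOn (T.glue w) (w K) (openCell K) := fun K hK =>
    T.eqOn_glue w hK
  have hpq : ∀ K ∈ T.cells, boundaryIntegral K (fun _ y => q y ^ 2) =
      boundaryIntegral K (fun F y => p F y ^ 2) := fun K hK =>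
    boundaryIntegral_congr_ae fun F hF => by
      filter_upwards [(hp F (T.mem_facets hK hF)).2] with y hy
      rw [hy]
  have hP : T.normP q ^ 2 =
      ∑ K ∈ T.cells, hK K * boundaryIntegral K (fun F y => p F y ^ 2) := by
    rw [normP, Real.sq_sqrt]
    · exact Finset.sum_congr rfl fun K hK => by rw [hpq K hK]
    · exact Finset.sum_nonneg fun K hK =>
        mul_nonneg (hK_pos hK).le (boundaryIntegral_nonneg fun _ _ => sq_nonneg _)
  have hgrad : ∀ K, 0 ≤ ∫ x in openCell K, gradSq (w K) x := fun K =>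
    integral_nonneg fun x => gradSq_nonneg _ x
  have hN : T.normV α (T.glue w) 0 ^ 2 =
      ∑ K ∈ T.cells, (∫ x in openCell K, gradSq (w K) x) +
      ∑ K ∈ T.cells, α * ((hK K)⁻¹ * boundaryIntegral K (fun _ x => ‖w K x‖ ^ 2)) := by
    simp only [← mul_assoc]
    rw [normV_eq hcont hglue, Real.sq_sqrt]
    refine add_nonneg (Finset.sum_nonneg fun K _ => hgrad K) (Finset.sum_nonneg fun K hK => ?_)
    have h1 := hK_pos hK
    have h2 : 0 ≤ boundaryIntegral K (fun _ x => ‖w K x‖ ^ 2) :=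
      boundaryIntegral_nonneg fun _ _ => sq_nonneg _
    positivity
  refine ⟨T.glue w, fun K hK => ⟨w K, (hw K hK).1, hglue K hK⟩, ?_, ?_, ?_⟩
  · rw [b2_eq hcont hglue, hP]
    refine Finset.sum_congr rfl fun K hK => ?_
    rw [← boundaryIntegral_const_mul]
    refine boundaryIntegral_congr_ae fun F hF => ?_
    filter_upwards [(hp F (T.mem_facets hK hF)).2,
      ae_restrict_of_forall_mem (measurableSet_simplex F) fun y hy => hy] with y hy hyF
    rw [(hw K hK).2.1 F hF y hyF, hy]
    ring
  · rw [hN, hP, add_mul, Finset.mul_sum, Finset.mul_sum]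
    refine add_le_add (Finset.sum_le_sum fun K hK => (hw K hK).2.2.1)
      (Finset.sum_le_sum fun K hK => ?_)
    rw [mul_assoc]
    exact mul_le_mul_of_nonneg_left (hw K hK).2.2.2.1 hα.le
  · rw [hN, hP, Finset.mul_sum]
    refine le_add_of_nonneg_of_le (Finset.sum_nonneg fun K _ => hgrad K)
      (Finset.sum_le_sum fun K hK => ?_)
    exact mul_le_mul_of_nonneg_left (hw K hK).2.2.2.2 hα.le

/-- The inf-sup condition in any dimension `n + 1`. -/
theorem infSup (n k : ℕ) (hk : 1 ≤ k) {α σ : ℝ} (hα : 0 < α) (hσ : 0 < σ) :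
    ∃ β > 0, ∀ (Ω : Set (E (n + 1))), IsOpen Ω → Ω.Nonempty →
      ∀ (T : Triangulation (n + 1) Ω), T.ShapeRegular σ → ∀ q ∈ T.Qbar k,
        ∃ v ∈ T.Vh k, T.normV α v 0 ≠ 0 ∧ β * T.normP q ≤ T.b2 q v / T.normV α v 0 := by
  obtain ⟨C, hC, hglob⟩ := exists_global_lifting n k hk hα hσ
  -- With `b₂ = ‖q‖_p²` and `|||(v, 0)|||_v ≤ √C ‖q‖_p`, the quotient is at least `‖q‖_p / √C`.
  refine ⟨(Real.sqrt C)⁻¹, by positivity, fun Ω hΩ hne T hT q hq => ?_⟩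
  have hP0 : 0 ≤ T.normP q := Real.sqrt_nonneg _
  -- If `‖q‖_p = 0` the lifting may have zero norm and be excluded from the supremum. The supremum
  -- over no pairs would be `⊥`, so an admissible pair with nonnegative quotient is still required.
  rcases hP0.eq_or_lt with h0 | hpos
  · obtain ⟨v, hv, hv1, hv2⟩ := exists_quotient_nonneg (T.cells_nonempty hΩ hne) hT k hα q
    exact ⟨v, hv, hv1, by rw [← h0, mul_zero]; exact hv2⟩
  · obtain ⟨v, hv, hb, hup, hlow⟩ := hglob Ω T hT q hq
    have hV : 0 < T.normV α v 0 := by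
      refine (Real.sqrt_nonneg _).lt_of_ne' fun h => ?_
      have : 0 < α * T.normP q ^ 2 := by positivity
      rw [show T.normV α v 0 = 0 from h] at hlow
      linarith
    refine ⟨v, hv, hV.ne', ?_⟩
    have hup' : T.normV α v 0 ≤ Real.sqrt C * T.normP q := by
      refine (sq_le_sq₀ hV.le (by positivity)).1 ?_
      rwa [mul_pow, Real.sq_sqrt hC.le]
    rw [hb, le_div_iff₀ hV]
    calc (Real.sqrt C)⁻¹ * T.normP q * T.normV α v 0
        ≤ (Real.sqrt C)⁻¹ * T.normP q * (Real.sqrt C * T.normP q) := by gcongr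
      _ = T.normP q ^ 2 := by
        have := (Real.sqrt_pos.2 hC).ne'
        field_simp

end Triangulation

end HDG

theorem mainTheorem8 (d : ℕ) (hd : d = 2 ∨ d = 3) (k : ℕ) (hk : 1 ≤ k)
    (α : ℝ) (hα : 0 < α) (σ : ℝ) (hσ : 0 < σ) :
    ∃ β : ℝ, 0 < β ∧
      ∀ (Ω : Set (HDG.E d)), IsOpen Ω → IsConnected Ω →
      ∀ (T : HDG.Triangulation d Ω), T.ShapeRegular σ →
      ∀ qbar ∈ T.Qbar k,
        ((β * T.normP qbar : ℝ) : EReal) ≤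
          ⨆ (v : HDG.E d → HDG.E d) (vbar : HDG.E d → HDG.E d)
            (_ : v ∈ T.Vh k ∧ vbar ∈ T.Vbar k ∧ T.normV α v vbar ≠ 0),
            ((T.b2 qbar v / T.normV α v vbar : ℝ) : EReal) := by
  obtain ⟨n, rfl⟩ : ∃ n, d = n + 1 := ⟨d - 1, by omega⟩
  obtain ⟨β, hβ, h⟩ := HDG.Triangulation.infSup n k hk hα hσ
  refine ⟨β, hβ, fun Ω hΩ hconn T hT q hq => ?_⟩
  obtain ⟨v, hv, hV, hle⟩ := h Ω hΩ hconn.nonempty T hT q hq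
  exact le_iSup_of_le v (le_iSup_of_le 0 (le_iSup_of_le
    ⟨hv, HDG.Triangulation.zero_mem_Vbar k, hV⟩ (EReal.coe_le_coe_iff.2 hle)))
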